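/- **Setting.** Let $\mathcal X$ be a measurable space and let $x\mapsto p_{Y|x}$ be a measurable map (a classifier) from $\mathcal X$ to the probability vectors on $[d]=\{1,\dots,d\}$. Let $p_1,\dots,p_G$ ($G\ge 1$) be probability distributions on $\mathcal X$ (the generative models), with marginal class distributions $p_{Y_g}=\mathbb E_{X\sim p_g}[p_{Y|X}]$ and Inception scores $$\mathrm{IS}_g=\exp\big\{\mathbb E_{X\sim p_g}[\mathrm{KL}(p_{Y|X}\,\|\,p_{Y_g})]\big\}.$$ For $z\in\mathbb R_+^d$ put $\mathcal E(z)=-\sum_j z[j]\log z[j]$ (with $0\log 0=0$). For $n\ge2$ samples $x^1,\dots,x^n$ and a number $\delta'>0$, put $\ell=\log(4d/\delta')$, let $\widetilde p=\frac1n\sum_i p_{Y|x^i}$ and $\widehat H=\frac1n\sum_i\mathcal E(p_{Y|x^i})$, and let $\widehat V(z_1,\dots,z_n)=\frac1{n(n-1)}\sum_{i<j}(z_i-z_j)^2$ be the sample variance. Let $$\epsilon[j]=\sqrt{\tfrac{2}{n}\widehat V\big((p_{Y|x^i}[j])_i\big)\,\ell}+\tfrac{7}{3(n-1)}\,\ell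 ,$$ let $\widehat p[j]$ be the point obtained from $\widetilde p[j]$ by moving it by $\epsilon[j]$ towards $e^{-1}$ (but not beyond $e^{-1}$), and define the optimistic score $$\widehat{\mathrm{IS}}=\exp\Big\{\mathcal E(\widehat p)-\widehat H+\sqrt{\tfrac{2}{n}\widehat V\big((\mathcal E(p_{Y|x^i}))_i\big)\,\ell}+\tfrac{7\log d}{3(n-1)}\,\ell\Big\};$$ for $n\le 1$ put $\widehat{\mathrm{IS}}=\infty$. **Algorithm IS-UCB** (number of steps $T\ge1$, batch size $b\ge1$, failure probability $\delta\in(0,1)$). At each step $t=1,\dots,T$, pick a model $g_t$ that maximizes the optimistic score $\widehat{\mathrm{IS}}_g$, computed with $\delta'=\delta/T$ from all samples generated by model $g$ so far (ties are broken arbitrarily), and let $g_t$ generate $b$ new samples. The samples of each model are i.i.d. from its distribution, and all samples are independent. The regret is $\mathrm{Regret}(T)=\sum_{t=1}^T(\max_g\mathrm{IS}_g-\mathrm{IS}_{g_t})$. **Theorem (Regret of IS-UCB).** There are universal constants $K>0$ and $k\in\mathbb N$ and numbers $C=C(d,G)$ with $0\le C\le Kd+\frac12\log G$ (so $C=\widetilde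 O(d)$, where the hidden logarithm is that of $G$ only) such that, in the setting above, with probability at least $1-\delta$, $$\mathrm{Regret}(T)\le K\,\log^k\!\Big(\frac{4dT}{\delta}\Big)\Big(G\,\Delta^{-2}\log d+e^{C}\big((dm+\log d)\sqrt T+\log T\big)\Big),$$ where, with $u(x)=-x\log x$, $$m=\max_{g,j:\ p_{Y_g}[j]>0}|u'(p_{Y_g}[j])|,\qquad \Delta=\min_{g,j:\ p_{Y_g}[j]\ne e^{-1}}|p_{Y_g}[j]-e^{-1}| .$$ -/

import Mathlib

open MeasureTheory ProbabilityTheory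

noncomputable section

namespace ISUCB

/-! Throughout, `q x j` is the probability `p_{Y|x}[j]` that a fixed classifier assigns to the
class `j ∈ [d]` of the sample `x`, and `p` is the distribution of the samples of one model. -/

section Score

variable {𝒳 : Type*} [MeasurableSpace 𝒳] {d : ℕ}

/-- The marginal class probability `p_Y[j] = 𝔼_{X ∼ p} p_{Y|X}[j]`. -/
def marginal (q : 𝒳 → Fin d → ℝ) (p : Measure 𝒳) (j : Fin d) : ℝ :=
  ∫ x, q x j ∂p

/-- The Kullback-Leibler divergence `∑ j, r[j] log (r[j] / s[j])` of two distributions on `[d]`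
(a term with `r[j] = 0` is `0`; it is only used below where, almost surely, `s[j] = 0` implies
`r[j] = 0`). -/
def kl (r s : Fin d → ℝ) : ℝ :=
  ∑ j, r j * Real.log (r j / s j)

/-- The Inception score `exp (𝔼_{X ∼ p} KL(p_{Y|X} ‖ p_Y))`. -/
def inceptionScore (q : 𝒳 → Fin d → ℝ) (p : Measure 𝒳) : ℝ :=
  Real.exp (∫ x, kl (q x) (marginal q p) ∂p)

end Score

section Estimators

/-- `𝓔(z) = - ∑ j, z[j] log z[j]`; on probability vectors it is the Shannon entropy. -/
def entropy {d : ℕ} (z : Fin d → ℝ) : ℝ :=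
  ∑ j, Real.negMulLog (z j)

/-- The empirical mean of the first `n` terms of `z`. -/
def sampleMean (z : ℕ → ℝ) (n : ℕ) : ℝ :=
  (∑ i ∈ Finset.range n, z i) / n

/-- The sample variance `(n (n - 1))⁻¹ ∑_{i < j} (z_i - z_j)²` of the first `n` terms of `z`. -/
def sampleVar (z : ℕ → ℝ) (n : ℕ) : ℝ :=
  (∑ j ∈ Finset.range n, ∑ i ∈ Finset.range j, (z i - z j) ^ 2) / ((n : ℝ) * ((n : ℝ) - 1))

/-- The empirical Bernstein radius for `n` values in an interval of length `R`, with the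
logarithmic factor `log (4 d / δ)`. -/
def radius (d : ℕ) (δ R : ℝ) (z : ℕ → ℝ) (n : ℕ) : ℝ :=
  Real.sqrt (2 * sampleVar z n / n * Real.log (4 * d / δ))
    + 7 * R / (3 * ((n : ℝ) - 1)) * Real.log (4 * d / δ)

/-- The operator `Clip_{e⁻¹}` on one coordinate: move `p` by `ε` towards `e⁻¹`, but not beyond. -/
def clip (p ε : ℝ) : ℝ :=
  if ε ≤ |Real.exp (-1) - p| then
    p + (Real.exp (-1) - p) / |Real.exp (-1) - p| * ε
  else Real.exp (-1)

variable {𝒳 : Type*} {d : ℕ}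

/-- The optimistic marginal class distribution computed from `x 0, …, x (n - 1)`. -/
def optimisticMarginal (q : 𝒳 → Fin d → ℝ) (δ : ℝ) (x : ℕ → 𝒳) (n : ℕ) (j : Fin d) : ℝ :=
  clip (sampleMean (fun i => q (x i) j) n) (radius d δ 1 (fun i => q (x i) j) n)

/-- The optimistic Inception score computed from `x 0, …, x (n - 1)`. It is `∞` before the first
sample and for `n = 1`, where the radius (which divides by `n - 1`) is infinite. -/
def optimisticIS (q : 𝒳 → Fin d → ℝ) (δ : ℝ) (x : ℕ → 𝒳) (n : ℕ) : EReal :=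
  if n ≤ 1 then ⊤
  else ((Real.exp (entropy (optimisticMarginal q δ x n)
      - sampleMean (fun i => entropy (q (x i))) n
      + radius d δ (Real.log d) (fun i => entropy (q (x i))) n) : ℝ) : EReal)

end Estimators

section Bandit

variable {𝒳 : Type*} {d G : ℕ}

/-- The number of times that the model `g` is picked in the steps before step `t`
(steps are numbered from `0`). -/
def visits (a : ℕ → Fin G) (t : ℕ) (g : Fin G) : ℕ :=
  ((Finset.range t).filter (fun s => a s = g)).card

/-- `a 0, …, a (T - 1)` is the sequence of models picked by IS-UCB, run for `T` steps with batch
size `b` and failure probability `δ / T` in the score, when `x g 0, x g 1, …` are the successive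
samples generated by the model `g`: every pick maximizes the current optimistic score (ties are
broken arbitrarily), and every time `g` is picked it generates its next `b` samples. -/
def IsRun (q : 𝒳 → Fin d → ℝ) (δ : ℝ) (b T : ℕ) (x : Fin G → ℕ → 𝒳) (a : ℕ → Fin G) : Prop :=
  ∀ t < T, ∀ g : Fin G,
    optimisticIS q (δ / T) (x g) (b * visits a t g)
      ≤ optimisticIS q (δ / T) (x (a t)) (b * visits a t (a t))

variable [MeasurableSpace 𝒳]

/-- `Regret(T) = ∑_t (max_g IS_g - IS_{g_t})`. -/
def regret (q : 𝒳 → Fin d → ℝ) (p : Fin G → Measure 𝒳) (T : ℕ) (a : ℕ → Fin G) : ℝ :=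
  ∑ t ∈ Finset.range T,
    ((⨆ g, inceptionScore q (p g)) - inceptionScore q (p (a t)))

/-- `m`, the largest `|u'|` of `u(x) = - x log x` at the positive marginal class probabilities. -/
def slope (q : 𝒳 → Fin d → ℝ) (p : Fin G → Measure 𝒳) : ℝ :=
  sSup {r | ∃ g j, 0 < marginal q (p g) j ∧ r = |deriv Real.negMulLog (marginal q (p g) j)|}

/-- `Δ`, the smallest distance to `e⁻¹` of the marginal class probabilities other than `e⁻¹`. -/
def gap (q : 𝒳 → Fin d → ℝ) (p : Fin G → Measure 𝒳) : ℝ :=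
  sInf {r | ∃ g j, marginal q (p g) j ≠ Real.exp (-1) ∧
    r = |marginal q (p g) j - Real.exp (-1)|}

end Bandit

end ISUCB

end

/-!
The logarithm of the Inception score of a model is the entropy of its marginal class distribution
minus its mean conditional entropy. Since `u(x) = -x log x` increases up to `e⁻¹` and decreases
afterwards, moving an estimated marginal towards `e⁻¹` by a confidence radius can only overestimate
the entropy. The radii come from an empirical Bernstein inequality: Bernstein's inequality for the
mean, and a lower tail bound for the sample variance, which is an average over all permutations of
the sample of sums over disjoint, hence independent, pairs.

Optimism at confidence level `L = log (4dT/δ)` is needed only for a best model, while the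
scores of all models may be estimated at level `3L`; this absorbs the union bound over the models
when `G ≤ T`, and for `T < G` the regret is at most `d T`, as every score lies in `[1, d]`. By
concavity of `u`, after `n` samples the optimistic score exceeds the true one by a rate of order
`n^(-1/2)`; classes of probability zero cause no trouble because their sample variance vanishes.
Summing the rates over the visits to each model and applying Cauchy-Schwarz gives `√(G T)`.
-/

noncomputable section

namespace ISUCB

section ExpBounds

theorem exp_le_quadratic_of_nonpos {x : ℝ} (hx : x ≤ 0) : Real.exp x ≤ 1 + x + x ^ 2 / 2 := by
  have hneg : 1 + -x + (-x) ^ 2 / 2 ≤ Real.exp (-x) :=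
    Real.quadratic_le_exp_of_nonneg (neg_nonneg.2 hx)
  have hprod : 1 ≤ (1 + x + x ^ 2 / 2) * (1 + -x + (-x) ^ 2 / 2) := by nlinarith [sq_nonneg (x ^ 2)]
  have hpos : 0 < 1 + x + x ^ 2 / 2 := by nlinarith [sq_nonneg (x + 1)]
  calc Real.exp x = 1 * Real.exp x := (one_mul _).symm
    _ ≤ (1 + x + x ^ 2 / 2) * (1 + -x + (-x) ^ 2 / 2) * Real.exp x := by gcongr
    _ ≤ (1 + x + x ^ 2 / 2) * Real.exp (-x) * Real.exp x := by gcongr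
    _ = 1 + x + x ^ 2 / 2 := by rw [mul_assoc, ← Real.exp_add, neg_add_cancel, Real.exp_zero,
        mul_one]

theorem exp_le_quadratic_of_lt_three {x : ℝ} (hx₀ : 0 ≤ x) (hx : x < 3) :
    Real.exp x ≤ 1 + x + x ^ 2 / (2 * (1 - x / 3)) := by
  have hexp : HasSum (fun n : ℕ ↦ x ^ (n + 2) / (n + 2).factorial) (Real.exp x - (1 + x)) := by
    have h := NormedSpace.expSeries_div_hasSum_exp x
    rw [← Real.exp_eq_exp_ℝ, ← hasSum_nat_add_iff' 2] at h
    simpa [Finset.sum_range_succ] using h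
  have hgeom : HasSum (fun n : ℕ ↦ x ^ 2 / 2 * (x / 3) ^ n) (x ^ 2 / 2 * (1 - x / 3)⁻¹) :=
    (hasSum_geometric_of_lt_one (by positivity) (by linarith)).mul_left _
  have hterm (n : ℕ) : x ^ (n + 2) / (n + 2).factorial ≤ x ^ 2 / 2 * (x / 3) ^ n := by
    have hfact : (2 * 3 ^ n : ℝ) ≤ (n + 2).factorial := by
      exact_mod_cast add_comm 2 n ▸ Nat.factorial_mul_pow_le_factorial (m := 2) (n := n)
    calc x ^ (n + 2) / (n + 2).factorial ≤ x ^ (n + 2) / (2 * 3 ^ n) := by gcongr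
      _ = x ^ 2 / 2 * (x / 3) ^ n := by rw [div_pow, pow_add]; field_simp
  have hle := hasSum_le hterm hexp hgeom
  rw [← div_eq_mul_inv, div_div] at hle
  linarith

theorem exp_le_quadratic {x t : ℝ} (hxt : x ≤ t) (ht₀ : 0 ≤ t) (ht : t < 3) :
    Real.exp x ≤ 1 + x + x ^ 2 / (2 * (1 - t / 3)) := by
  have hpos : 0 < 1 - t / 3 := by linarith
  rcases le_total x 0 with hx | hx
  · refine (exp_le_quadratic_of_nonpos hx).trans ?_
    gcongr
    linarith
  · refine (exp_le_quadratic_of_lt_three hx (hxt.trans_lt ht)).trans ?_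
    gcongr

end ExpBounds

section Bernstein

variable {Ω : Type*} [MeasurableSpace Ω] {μ : Measure Ω} [IsProbabilityMeasure μ]

theorem mgf_sub_integral_le {X : Ω → ℝ} {R s : ℝ} (hX : MemLp X 2 μ) (hR : 0 ≤ R)
    (hXR : ∀ᵐ ω ∂μ, X ω - μ[X] ≤ R) (hs : 0 ≤ s) (hsR : s * R < 3) :
    mgf (fun ω ↦ X ω - μ[X]) μ s ≤ Real.exp (s ^ 2 * Var[X; μ] / (2 * (1 - s * R / 3))) := by
  set c := 2 * (1 - s * R / 3)
  have hint : Integrable X μ := hX.integrable one_le_two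
  have hdiff : Integrable (fun ω ↦ s * (X ω - μ[X])) μ :=
    (hint.sub (integrable_const _)).const_mul s
  have hlin : Integrable (fun ω ↦ 1 + s * (X ω - μ[X])) μ := (integrable_const 1).add hdiff
  have hsq : Integrable (fun ω ↦ s ^ 2 * (X ω - μ[X]) ^ 2 / c) μ :=
    (((hX.sub (memLp_const _)).integrable_sq).const_mul _).div_const _
  calc mgf (fun ω ↦ X ω - μ[X]) μ s
      ≤ ∫ ω, (1 + s * (X ω - μ[X]) + s ^ 2 * (X ω - μ[X]) ^ 2 / c) ∂μ := by
        refine integral_mono_of_nonneg (ae_of_all _ fun ω ↦ (Real.exp_pos _).le) (hlin.add hsq) ?_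
        filter_upwards [hXR] with ω hω
        rw [← mul_pow]
        exact exp_le_quadratic (mul_le_mul_of_nonneg_left hω hs) (mul_nonneg hs hR) hsR
    _ = s ^ 2 * Var[X; μ] / c + 1 := by
        rw [integral_add hlin hsq, integral_add (integrable_const 1) hdiff, integral_const_mul,
          integral_sub hint (integrable_const _), integral_div, integral_const_mul,
          variance_eq_integral hX.aestronglyMeasurable.aemeasurable]
        simp [add_comm]
    _ ≤ _ := Real.add_one_le_exp _

theorem mgf_sum_sub_integral_le {ι : Type*} {Z : ι → Ω → ℝ} {R s : ℝ} (hZ : ∀ i, MemLp (Z i) 2 μ)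
    (hind : iIndepFun Z μ) (hR : 0 ≤ R) (hZR : ∀ i, ∀ᵐ ω ∂μ, Z i ω - μ[Z i] ≤ R) (hs : 0 ≤ s)
    (hsR : s * R < 3) (S : Finset ι) :
    mgf (fun ω ↦ ∑ i ∈ S, (Z i ω - μ[Z i])) μ s
      ≤ Real.exp (s ^ 2 * (∑ i ∈ S, Var[Z i; μ]) / (2 * (1 - s * R / 3))) := by
  have hcentered : iIndepFun (fun i ω ↦ Z i ω - μ[Z i]) μ :=
    hind.comp (fun i x ↦ x - ∫ ω, Z i ω ∂μ) fun i ↦ measurable_id.sub_const _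
  have hmgf := hcentered.mgf_sum₀ (t := s)
    (fun i ↦ (hZ i).aestronglyMeasurable.aemeasurable.sub_const _) S
  rw [show ∑ i ∈ S, (fun ω ↦ Z i ω - μ[Z i]) = fun ω ↦ ∑ i ∈ S, (Z i ω - μ[Z i]) by
    ext ω; simp only [Finset.sum_apply]] at hmgf
  rw [hmgf, Finset.mul_sum, Finset.sum_div, Real.exp_sum]
  exact Finset.prod_le_prod (fun _ _ ↦ mgf_nonneg)
    fun i _ ↦ mgf_sub_integral_le (hZ i) hR (hZR i) hs hsR

theorem measureReal_le_sum_sub_integral_le {ι : Type*} {Z : ι → Ω → ℝ} {R s : ℝ}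
    (hZ : ∀ i, MemLp (Z i) 2 μ) (hind : iIndepFun Z μ) (hR : 0 ≤ R)
    (hZR : ∀ i, ∀ᵐ ω ∂μ, Z i ω - μ[Z i] ≤ R) (hs : 0 ≤ s) (hsR : s * R < 3) (S : Finset ι)
    (ε : ℝ) :
    μ.real {ω | ε ≤ ∑ i ∈ S, (Z i ω - μ[Z i])}
      ≤ Real.exp (-s * ε + s ^ 2 * (∑ i ∈ S, Var[Z i; μ]) / (2 * (1 - s * R / 3))) := by
  have hint : Integrable (fun ω ↦ Real.exp (s * ∑ i ∈ S, (Z i ω - μ[Z i]))) μ := by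
    refine integrable_exp_mul_of_le s (∑ _ ∈ S, R) hs (Finset.aemeasurable_fun_sum _ fun i _ ↦
      (hZ i).aestronglyMeasurable.aemeasurable.sub_const _) ?_
    filter_upwards [(ae_ball_iff S.countable_toSet).2 fun i _ ↦ hZR i] with ω hω
    exact Finset.sum_le_sum hω
  rw [Real.exp_add]
  refine (measure_ge_le_exp_mul_mgf ε hs hint).trans ?_
  gcongr
  exact mgf_sum_sub_integral_le hZ hind hR hZR hs hsR S

theorem ae_sum_sub_integral_eq_zero {ι : Type*} {Z : ι → Ω → ℝ} (hZ : ∀ i, MemLp (Z i) 2 μ)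
    {S : Finset ι} (hS : ∑ i ∈ S, Var[Z i; μ] = 0) :
    ∀ᵐ ω ∂μ, ∑ i ∈ S, (Z i ω - μ[Z i]) = 0 := by
  have hzero : ∀ᵐ ω ∂μ, ∀ i ∈ S, Z i ω = μ[Z i] :=
    (ae_ball_iff S.countable_toSet).2 fun i hi ↦ ae_eq_integral_of_variance_eq_zero (hZ i)
      ((Finset.sum_eq_zero_iff_of_nonneg fun i _ ↦ variance_nonneg _ _).1 hS i hi)
  filter_upwards [hzero] with ω hω
  exact Finset.sum_eq_zero fun i hi ↦ sub_eq_zero.2 (hω i hi)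

/-- **Bernstein's inequality**. -/
theorem measureReal_sqrt_add_lt_sum_sub_integral_le {ι : Type*} {Z : ι → Ω → ℝ} {R L : ℝ}
    (hZ : ∀ i, MemLp (Z i) 2 μ) (hind : iIndepFun Z μ) (hR : 0 ≤ R)
    (hZR : ∀ i, ∀ᵐ ω ∂μ, Z i ω - μ[Z i] ≤ R) (hL : 0 ≤ L) (S : Finset ι) :
    μ.real {ω | √(2 * (∑ i ∈ S, Var[Z i; μ]) * L) + R * L / 3 < ∑ i ∈ S, (Z i ω - μ[Z i])}
      ≤ Real.exp (-L) := by
  set v := ∑ i ∈ S, Var[Z i; μ]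
  have hv₀ : 0 ≤ v := Finset.sum_nonneg fun i _ ↦ variance_nonneg _ _
  rcases hv₀.eq_or_lt with hv | hv
  · have hnull : μ {ω | √(2 * v * L) + R * L / 3 < ∑ i ∈ S, (Z i ω - μ[Z i])} = 0 := by
      rw [measure_eq_zero_iff_ae_notMem]
      filter_upwards [ae_sum_sub_integral_eq_zero hZ hv.symm] with ω hω
      rw [hω, not_lt]
      positivity
    simpa only [measureReal_def, hnull, ENNReal.toReal_zero] using (Real.exp_pos _).le
  -- `r` is the optimal exponent of the Gaussian part; dividing it by `1 + r * R / 3` makes the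
  -- Chernoff exponent equal to `L` exactly.
  set r := √(2 * L / v)
  set c := 1 + r * R / 3 with hc_def
  have hc : 0 < c := by positivity
  have hr : r ^ 2 * v = 2 * L := by rw [Real.sq_sqrt (by positivity)]; field_simp
  have hsqrt : √(2 * v * L) = r * v := by
    rw [Real.sqrt_eq_iff_mul_self_eq (by positivity) (by positivity)]
    linear_combination -v * hr
  have hinv : 1 - r / c * R / 3 = c⁻¹ := by field_simp; linear_combination 3 * hc_def
  have hsR : r / c * R < 3 := by linarith [inv_pos.2 hc]
  calc μ.real {ω | √(2 * v * L) + R * L / 3 < ∑ i ∈ S, (Z i ω - μ[Z i])}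
      ≤ μ.real {ω | r * v + R * L / 3 ≤ ∑ i ∈ S, (Z i ω - μ[Z i])} := by
        rw [hsqrt]
        exact measureReal_mono (Set.ofPred_subset_ofPred.2 fun ω hω ↦ hω.le)
    _ ≤ Real.exp (-(r / c) * (r * v + R * L / 3) + (r / c) ^ 2 * v / (2 * (1 - r / c * R / 3))) :=
        measureReal_le_sum_sub_integral_le hZ hind hR hZR (by positivity) hsR S _
    _ = Real.exp (-L) := by
        rw [hinv]
        congr 1
        field_simp
        linear_combination -3 * hr + 6 * L * hc_def

end Bernstein

section SampleVariance

variable {Ω : Type*} [MeasurableSpace Ω] {μ : Measure Ω}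

theorem mgf_sum_mul_le {ι : Type*} {S : Finset ι} {w : ι → ℝ} {X : ι → Ω → ℝ} {s C : ℝ}
    (hw : ∀ i ∈ S, 0 ≤ w i) (hw₁ : ∑ i ∈ S, w i = 1)
    (hint : ∀ i ∈ S, Integrable (fun ω ↦ Real.exp (s * X i ω)) μ)
    (hC : ∀ i ∈ S, mgf (X i) μ s ≤ C) : mgf (fun ω ↦ ∑ i ∈ S, w i * X i ω) μ s ≤ C := by
  have hint' : ∀ i ∈ S, Integrable (fun ω ↦ w i * Real.exp (s * X i ω)) μ :=
    fun i hi ↦ (hint i hi).const_mul _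
  calc mgf (fun ω ↦ ∑ i ∈ S, w i * X i ω) μ s
      ≤ ∫ ω, ∑ i ∈ S, w i * Real.exp (s * X i ω) ∂μ := by
        refine integral_mono_of_nonneg (ae_of_all _ fun ω ↦ (Real.exp_pos _).le)
          (integrable_finsetSum _ hint') (ae_of_all _ fun ω ↦ ?_)
        have hjensen := convexOn_exp.map_sum_le (p := fun i ↦ s * X i ω) hw hw₁
          fun i _ ↦ Set.mem_univ _
        simpa only [smul_eq_mul, mul_left_comm, ← Finset.mul_sum] using hjensen
    _ = ∑ i ∈ S, w i * mgf (X i) μ s := by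
        rw [integral_finsetSum _ hint']
        simp only [integral_const_mul, mgf]
    _ ≤ ∑ i ∈ S, w i * C :=
        Finset.sum_le_sum fun i hi ↦ mul_le_mul_of_nonneg_left (hC i hi) (hw i hi)
    _ = C := by rw [← Finset.sum_mul, hw₁, one_mul]

variable [IsProbabilityMeasure μ]

theorem iIndepFun_curry {ι κ E : Type*} [MeasurableSpace E] {Z : ι × κ → Ω → E}
    (hZ : ∀ i, Measurable (Z i)) (hind : iIndepFun Z μ) :
    iIndepFun (fun i ω j ↦ Z (i, j) ω) μ := by
  have _ (i) : IsProbabilityMeasure (μ.map (Z i)) :=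
    Measure.isProbabilityMeasure_map (hZ i).aemeasurable
  have hrow (i : ι) : iIndepFun (fun j ↦ Z (i, j)) μ :=
    hind.precomp (g := (i, ·)) (Prod.mk_right_injective i)
  rw [iIndepFun_iff_map_fun_eq_infinitePi_map (fun i ↦ by fun_prop)]
  calc μ.map (fun ω i j ↦ Z (i, j) ω)
      = (μ.map fun ω s ↦ Z s ω).map (MeasurableEquiv.curry ι κ E) := by
        rw [Measure.map_map (by fun_prop) (by fun_prop)]; rfl
    _ = Measure.infinitePi fun i ↦ Measure.infinitePi fun j ↦ μ.map (Z (i, j)) := by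
        rw [hind.map_fun_eq_infinitePi_map hZ]
        exact Measure.infinitePi_map_curry (fun i j ↦ μ.map (Z (i, j)))
    _ = Measure.infinitePi fun i ↦ μ.map fun ω j ↦ Z (i, j) ω := by
        congr 1 with i : 1
        exact ((hrow i).map_fun_eq_infinitePi_map fun j ↦ hZ _).symm

theorem card_offDiag_nsmul_sum_perm {α M : Type*} [Fintype α] [DecidableEq α] [AddCommMonoid M]
    (f : α × α → M) {a b : α} (hab : a ≠ b) :
    (Finset.univ : Finset α).offDiag.card • ∑ σ : Equiv.Perm α, f (σ a, σ b)
      = Fintype.card (Equiv.Perm α) • ∑ x ∈ (Finset.univ : Finset α).offDiag, f x := by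
  have htrans : ∀ x ∈ (Finset.univ : Finset α).offDiag,
      ∑ σ : Equiv.Perm α, f (σ x.1, σ x.2) = ∑ σ : Equiv.Perm α, f (σ a, σ b) := by
    intro x hx
    obtain ⟨τ, hτa, hτb⟩ := MulAction.is_two_pretransitive_iff.1
      (Equiv.Perm.isMultiplyPretransitive α 2) hab (Finset.mem_offDiag.1 hx).2.2
    refine Fintype.sum_equiv (Equiv.mulRight τ) _ _ fun σ ↦ ?_
    simp only [Equiv.coe_mulRight, Equiv.Perm.mul_apply, ← Equiv.Perm.smul_def τ, hτa, hτb]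
  have hperm (σ : Equiv.Perm α) : ∑ x ∈ (Finset.univ : Finset α).offDiag, f (σ x.1, σ x.2)
      = ∑ x ∈ (Finset.univ : Finset α).offDiag, f x :=
    Finset.sum_equiv (σ.prodCongr σ) (fun x ↦ by simp) fun x _ ↦ rfl
  rw [← Finset.sum_const, ← Finset.sum_congr rfl htrans, Finset.sum_comm,
    Finset.sum_congr rfl fun σ _ ↦ hperm σ, Finset.sum_const, Finset.card_univ]

theorem sampleVar_nonneg (z : ℕ → ℝ) (n : ℕ) : 0 ≤ sampleVar z n := by
  refine div_nonneg (Finset.sum_nonneg fun j _ ↦ Finset.sum_nonneg fun i _ ↦ sq_nonneg _) ?_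
  rcases n.eq_zero_or_pos with rfl | hn
  · simp
  · have : (1 : ℝ) ≤ n := by exact_mod_cast hn
    nlinarith

theorem sampleVar_eq_sum_offDiag (z : ℕ → ℝ) (n : ℕ) :
    sampleVar z n = (∑ x ∈ (Finset.univ : Finset (Fin n)).offDiag, (z x.1 - z x.2) ^ 2 / 2)
      / (n * (n - 1)) := by
  have hsplit (i : Fin n) : ∑ j : Fin n, (z i - z j) ^ 2
      = ∑ j ∈ Finset.range n, (z i - z j) ^ 2 := (Finset.sum_range fun j ↦ (z i - z j) ^ 2).symm
  have hfull : ∑ x ∈ (Finset.univ : Finset (Fin n)).offDiag, (z x.1 - z x.2) ^ 2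
      = ∑ i ∈ Finset.range n, ∑ j ∈ Finset.range n, (z i - z j) ^ 2 := by
    rw [Finset.sum_range, ← Finset.sum_congr rfl fun i _ ↦ hsplit i, ← Finset.sum_product',
      Finset.univ_product_univ]
    refine Finset.sum_subset (Finset.subset_univ _) fun x _ hx ↦ ?_
    have : x.1 = x.2 := by simpa using hx
    simp [this]
  have hlt (m : ℕ) : ∑ i ∈ Finset.range m, ∑ j ∈ Finset.range m, (z i - z j) ^ 2
      = 2 * ∑ j ∈ Finset.range m, ∑ i ∈ Finset.range j, (z i - z j) ^ 2 := by
    induction m with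
    | zero => simp
    | succ m ih =>
      simp only [Finset.sum_range_succ, Finset.sum_add_distrib, ih, sub_sq_comm (z m), mul_add]
      ring
  rw [sampleVar, ← Finset.sum_div, hfull, hlt, mul_div_cancel_left₀ _ two_ne_zero]

/-- Averaging over all permutations of the sample turns the sample variance, whose summands are
dependent, into a mean of sums over disjoint pairs of samples. -/
theorem sampleVar_eq_sum_perm (z : ℕ → ℝ) {n N : ℕ} (hN : N ≠ 0) (e : Fin N × Fin 2 ↪ Fin n) :
    sampleVar z n = ∑ σ : Equiv.Perm (Fin n), (Fintype.card (Equiv.Perm (Fin n)) : ℝ)⁻¹ *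
      ((∑ k, (z (σ (e (k, 0))) - z (σ (e (k, 1)))) ^ 2 / 2) / N) := by
  set c : ℝ := (Fintype.card (Equiv.Perm (Fin n)) : ℝ)
  have hn : 2 ≤ n := by
    have := Fintype.card_le_of_embedding e
    simp only [Fintype.card_prod, Fintype.card_fin] at this
    omega
  have hn₂ : (2 : ℝ) ≤ n := by exact_mod_cast hn
  have hpair (k : Fin N) :
      ∑ σ : Equiv.Perm (Fin n), (z (σ (e (k, 0))) - z (σ (e (k, 1)))) ^ 2 / 2
        = c * sampleVar z n := by
    have h := card_offDiag_nsmul_sum_perm (fun x : Fin n × Fin n ↦ (z x.1 - z x.2) ^ 2 / 2)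
      (e.injective.ne (by simp : (k, (0 : Fin 2)) ≠ (k, 1)))
    rw [Finset.offDiag_card, Finset.card_univ, Fintype.card_fin, nsmul_eq_mul, nsmul_eq_mul,
      Nat.cast_sub (Nat.le_mul_self n), Nat.cast_mul] at h
    rw [sampleVar_eq_sum_offDiag, mul_div_assoc', eq_div_iff (by nlinarith), ← h]
    ring
  have hc : c ≠ 0 := Nat.cast_ne_zero.2 Fintype.card_ne_zero
  rw [← Finset.mul_sum, ← Finset.sum_div, Finset.sum_comm, Finset.sum_congr rfl fun k _ ↦ hpair k,
    Finset.sum_const, Finset.card_univ, Fintype.card_fin, nsmul_eq_mul]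
  field_simp

theorem mgf_neg_le {D : Ω → ℝ} {B s : ℝ} (hD : AEMeasurable D μ)
    (hDB : ∀ᵐ ω ∂μ, D ω ∈ Set.Icc 0 B) (hs : 0 ≤ s) :
    mgf D μ (-s) ≤ Real.exp (-s * μ[D] + s ^ 2 * B * μ[D] / 2) := by
  have hint : Integrable D μ := Integrable.of_mem_Icc 0 B hD hDB
  calc mgf D μ (-s) ≤ ∫ ω, (1 + (-s + s ^ 2 * B / 2) * D ω) ∂μ := by
        refine integral_mono_of_nonneg (ae_of_all _ fun ω ↦ (Real.exp_pos _).le)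
          ((integrable_const 1).add (hint.const_mul _)) ?_
        filter_upwards [hDB] with ω ⟨h₀, hB⟩
        have hexp := exp_le_quadratic_of_nonpos (by nlinarith : -s * D ω ≤ 0)
        have hsq : s ^ 2 * (D ω * D ω) ≤ s ^ 2 * (B * D ω) := by gcongr
        linarith
    _ = -s * μ[D] + s ^ 2 * B * μ[D] / 2 + 1 := by
        rw [integral_add (integrable_const 1) (hint.const_mul _), integral_const_mul]
        simp; ring
    _ ≤ _ := Real.add_one_le_exp _

theorem integral_sq_sub_div_two {X Y : Ω → ℝ} (hX : MemLp X 2 μ) (hY : MemLp Y 2 μ)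
    (hXY : IndepFun X Y μ) (hmean : μ[X] = μ[Y]) (hvar : Var[X; μ] = Var[Y; μ]) :
    ∫ ω, (X ω - Y ω) ^ 2 / 2 ∂μ = Var[Y; μ] := by
  have hsub : μ[X - Y] = 0 := by
    simp only [Pi.sub_apply]
    rw [integral_sub (hX.integrable one_le_two) (hY.integrable one_le_two), hmean, sub_self]
  have h := variance_sub hX hY
  rw [hXY.covariance_eq_zero hX hY, hvar, variance_eq_sub (hX.sub hY), hsub] at h
  simp only [Pi.pow_apply, Pi.sub_apply] at h
  rw [integral_div]
  linarith

end SampleVariance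

section SampleVarianceTail

variable {Ω : Type*} [MeasurableSpace Ω] {μ : Measure Ω} [IsProbabilityMeasure μ]

theorem mgf_sum_sq_sub_div_le {ι : Type*} {Z : ι → Ω → ℝ} {a b V s : ℝ} {N : ℕ}
    (hZ : ∀ i, Measurable (Z i)) (hZab : ∀ i, ∀ᵐ ω ∂μ, Z i ω ∈ Set.Icc a b)
    (hind : iIndepFun Z μ) (hmean : ∀ i j, μ[Z i] = μ[Z j]) (hvar : ∀ i, Var[Z i; μ] = V)
    (hs : 0 ≤ s) (hN : N ≠ 0) (e : Fin N × Fin 2 ↪ ι) :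
    mgf (fun ω ↦ (∑ k, (Z (e (k, 0)) ω - Z (e (k, 1)) ω) ^ 2 / 2) / N) μ (-s)
      ≤ Real.exp (-s * V + s ^ 2 * (b - a) ^ 2 * V / (4 * N)) := by
  set D : Fin N → Ω → ℝ := fun k ω ↦ (Z (e (k, 0)) ω - Z (e (k, 1)) ω) ^ 2 / 2 with hD_def
  have hD (k : Fin N) : Measurable (D k) := by fun_prop
  have hDind : iIndepFun D μ :=
    (iIndepFun_curry (fun i ↦ hZ _) (hind.precomp e.injective)).comp
      (fun _ y ↦ (y 0 - y 1) ^ 2 / 2) fun _ ↦ by fun_prop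
  have hL2 (i : ι) : MemLp (Z i) 2 μ :=
    memLp_of_bounded (hZab i) (hZ i).aestronglyMeasurable 2
  have hDint (k : Fin N) : μ[D k] = V := by
    rw [integral_sq_sub_div_two (hL2 _) (hL2 _)
      (hind.indepFun (e.injective.ne (by simp))) (hmean _ _) ((hvar _).trans (hvar _).symm), hvar]
  have hDmem (k : Fin N) : ∀ᵐ ω ∂μ, D k ω ∈ Set.Icc 0 ((b - a) ^ 2 / 2) := by
    filter_upwards [hZab (e (k, 0)), hZab (e (k, 1))] with ω ⟨h₀, h₀'⟩ ⟨h₁, h₁'⟩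
    have : (Z (e (k, 0)) ω - Z (e (k, 1)) ω) ^ 2 ≤ (b - a) ^ 2 :=
      sq_le_sq' (by linarith) (by linarith)
    exact ⟨by positivity, by simp only [hD_def]; gcongr⟩
  have hmean_eq : (fun ω ↦ (∑ k, D k ω) / N) = fun ω ↦ (N : ℝ)⁻¹ * (∑ k, D k) ω := by
    ext ω
    rw [Finset.sum_apply, div_eq_inv_mul]
  calc mgf (fun ω ↦ (∑ k, D k ω) / N) μ (-s)
      = ∏ k, mgf (D k) μ (-((N : ℝ)⁻¹ * s)) := by
        rw [hmean_eq, mgf_const_mul, mul_neg, hDind.mgf_sum hD]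
    _ ≤ ∏ _k : Fin N, Real.exp (-((N : ℝ)⁻¹ * s) * V
          + ((N : ℝ)⁻¹ * s) ^ 2 * ((b - a) ^ 2 / 2) * V / 2) := by
        gcongr with k
        · exact fun _ _ ↦ mgf_nonneg
        · have h := mgf_neg_le (hD k).aemeasurable (hDmem k) (s := (N : ℝ)⁻¹ * s) (by positivity)
          rwa [hDint] at h
    _ = Real.exp (-s * V + s ^ 2 * (b - a) ^ 2 * V / (4 * N)) := by
        rw [Finset.prod_const, Finset.card_univ, Fintype.card_fin, ← Real.exp_nat_mul]
        congr 1
        field_simp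
        ring

theorem integrable_exp_neg_mul {D : Ω → ℝ} {s : ℝ} (hD : AEMeasurable D μ)
    (hD₀ : ∀ᵐ ω ∂μ, 0 ≤ D ω) (hs : 0 ≤ s) : Integrable (fun ω ↦ Real.exp (-s * D ω)) μ := by
  simpa only [Pi.neg_apply, mul_neg, neg_mul] using
    integrable_exp_mul_of_le s 0 hs hD.neg (hD₀.mono fun ω hω ↦ neg_nonpos.2 hω)

theorem mgf_sampleVar_neg_le {Z : ℕ → Ω → ℝ} {a b V s : ℝ} (hZ : ∀ i, Measurable (Z i))
    (hZab : ∀ i, ∀ᵐ ω ∂μ, Z i ω ∈ Set.Icc a b) (hind : iIndepFun Z μ)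
    (hmean : ∀ i j, μ[Z i] = μ[Z j]) (hvar : ∀ i, Var[Z i; μ] = V) (hs : 0 ≤ s) {n : ℕ}
    (hn : 2 ≤ n) :
    mgf (fun ω ↦ sampleVar (Z · ω) n) μ (-s)
      ≤ Real.exp (-s * V + s ^ 2 * (b - a) ^ 2 * V / (2 * (n - 1))) := by
  have hN : n / 2 ≠ 0 := by omega
  have hnN : 2 * ((n : ℝ) - 1) ≤ 4 * (n / 2 : ℕ) := by
    have h : n ≤ 2 * (n / 2) + 1 := by omega
    have h' : (n : ℝ) ≤ 2 * (n / 2 : ℕ) + 1 := by exact_mod_cast h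
    linarith
  have hn₁ : (0 : ℝ) < n - 1 := sub_pos.2 (by exact_mod_cast hn)
  have hV : 0 ≤ V := hvar 0 ▸ variance_nonneg _ _
  let e : Fin (n / 2) × Fin 2 ↪ Fin n :=
    finProdFinEquiv.toEmbedding.trans (Fin.castLEEmb (Nat.div_mul_le_self n 2))
  have hmgf (σ : Equiv.Perm (Fin n)) := mgf_sum_sq_sub_div_le (fun i : Fin n ↦ hZ i)
    (fun i ↦ hZab i) (hind.precomp Fin.val_injective) (fun i j ↦ hmean i j) (fun i ↦ hvar i) hs hN
    (e.trans σ.toEmbedding)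
  simp only [sampleVar_eq_sum_perm _ hN e]
  refine (mgf_sum_mul_le (fun _ _ ↦ by positivity) (by simp) (fun σ _ ↦ ?_)
    fun σ _ ↦ hmgf σ).trans ?_
  · exact integrable_exp_neg_mul (by fun_prop) (ae_of_all _ fun ω ↦ by positivity) hs
  · gcongr Real.exp (_ + _ / ?_)

theorem measureReal_sampleVar_le {Z : ℕ → Ω → ℝ} {a b V t : ℝ} (hZ : ∀ i, Measurable (Z i))
    (hZab : ∀ i, ∀ᵐ ω ∂μ, Z i ω ∈ Set.Icc a b) (hind : iIndepFun Z μ)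
    (hmean : ∀ i j, μ[Z i] = μ[Z j]) (hvar : ∀ i, Var[Z i; μ] = V) (hV : 0 < V) (hab : a ≠ b)
    (ht : 0 ≤ t) {n : ℕ} (hn : 2 ≤ n) :
    μ.real {ω | sampleVar (Z · ω) n ≤ V - t}
      ≤ Real.exp (-((n - 1) * t ^ 2 / (2 * (b - a) ^ 2 * V))) := by
  have hn₁ : (0 : ℝ) < n - 1 := sub_pos.2 (by exact_mod_cast hn)
  have hR : b - a ≠ 0 := sub_ne_zero.2 hab.symm
  set s := (n - 1) * t / ((b - a) ^ 2 * V)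
  have hs : 0 ≤ s := by positivity
  have hint : Integrable (fun ω ↦ Real.exp (-s * sampleVar (Z · ω) n)) μ :=
    integrable_exp_neg_mul (by unfold sampleVar; fun_prop)
      (ae_of_all _ fun ω ↦ sampleVar_nonneg _ n) hs
  calc μ.real {ω | sampleVar (Z · ω) n ≤ V - t}
      ≤ Real.exp (- -s * (V - t)) * mgf (fun ω ↦ sampleVar (Z · ω) n) μ (-s) :=
        measure_le_le_exp_mul_mgf _ (neg_nonpos.2 hs) hint
    _ ≤ Real.exp (- -s * (V - t))
          * Real.exp (-s * V + s ^ 2 * (b - a) ^ 2 * V / (2 * (n - 1))) := by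
        gcongr
        exact mgf_sampleVar_neg_le hZ hZab hind hmean hvar hs hn
    _ = Real.exp (-((n - 1) * t ^ 2 / (2 * (b - a) ^ 2 * V))) := by
        rw [← Real.exp_add]
        congr 1
        simp only [s]
        field_simp
        ring

theorem measureReal_sqrt_sampleVar_add_lt {Z : ℕ → Ω → ℝ} {a b V L : ℝ}
    (hZ : ∀ i, Measurable (Z i)) (hZab : ∀ i, ∀ᵐ ω ∂μ, Z i ω ∈ Set.Icc a b)
    (hind : iIndepFun Z μ) (hmean : ∀ i j, μ[Z i] = μ[Z j]) (hvar : ∀ i, Var[Z i; μ] = V)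
    (hL : 0 ≤ L) {n : ℕ} (hn : 2 ≤ n) :
    μ.real {ω | √(sampleVar (Z · ω) n) + (b - a) * √(2 * L / (n - 1)) < √V}
      ≤ Real.exp (-L) := by
  have hn₁ : (0 : ℝ) < n - 1 := sub_pos.2 (by exact_mod_cast hn)
  have hab : a ≤ b := by
    obtain ⟨ω, h₀, h₁⟩ := (hZab 0).exists
    exact h₀.trans h₁
  rcases le_or_gt V 0 with hV | hV
  · have hempty : {ω | √(sampleVar (Z · ω) n) + (b - a) * √(2 * L / (n - 1)) < √V} = ∅ := by
      refine Set.eq_empty_of_forall_notMem fun ω (hω : _ < √V) ↦ hω.not_ge ?_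
      rw [Real.sqrt_eq_zero_of_nonpos hV]
      exact add_nonneg (Real.sqrt_nonneg _) (mul_nonneg (sub_nonneg.2 hab) (Real.sqrt_nonneg _))
    simpa only [hempty, measureReal_empty] using (Real.exp_pos _).le
  have hne : a ≠ b := by
    rintro rfl
    have h := variance_le_sq_of_bounded (hZab 0) (hZ 0).aemeasurable
    rw [hvar, sub_self] at h
    linarith
  set c := (b - a) * √(2 * L / (n - 1)) with hc_def
  have hc : 0 ≤ c := mul_nonneg (sub_nonneg.2 hab) (Real.sqrt_nonneg _)
  have hsq : √V ^ 2 = V := Real.sq_sqrt hV.le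
  calc μ.real {ω | √(sampleVar (Z · ω) n) + c < √V}
      ≤ μ.real {ω | sampleVar (Z · ω) n ≤ V - √V * c} := by
        refine measureReal_mono (Set.ofPred_subset_ofPred.2 fun ω hω ↦ ?_)
        have hpow : √(sampleVar (Z · ω) n) ^ 2 ≤ (√V - c) ^ 2 := by
          gcongr
          linarith
        rw [Real.sq_sqrt (sampleVar_nonneg _ _)] at hpow
        nlinarith [Real.sqrt_nonneg (sampleVar (Z · ω) n)]
    _ ≤ Real.exp (-((n - 1) * (√V * c) ^ 2 / (2 * (b - a) ^ 2 * V))) :=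
        measureReal_sampleVar_le hZ hZab hind hmean hvar hV hne (by positivity) hn
    _ = Real.exp (-L) := by
        have hR : b - a ≠ 0 := sub_ne_zero.2 hne.symm
        rw [hc_def, mul_pow, mul_pow, hsq, Real.sq_sqrt (by positivity)]
        field_simp

end SampleVarianceTail

section EmpiricalBernstein

theorem natCast_mul_sampleMean (z : ℕ → ℝ) (n : ℕ) :
    n * sampleMean z n = ∑ i ∈ Finset.range n, z i := by
  rcases n.eq_zero_or_pos with rfl | hn
  · simp
  · rw [sampleMean]; field_simp

theorem sampleMean_neg (z : ℕ → ℝ) (n : ℕ) : sampleMean (fun i ↦ -z i) n = -sampleMean z n := by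
  simp only [sampleMean, Finset.sum_neg_distrib, neg_div]

/-- The empirical Bernstein radius of Maurer and Pontil with logarithmic factor `L`: the sample mean
of `n` values in an interval of length `R` is farther than this from the true mean only with
probability `O(exp (-L))`. -/
def bernsteinRadius (L R : ℝ) (z : ℕ → ℝ) (n : ℕ) : ℝ :=
  √(2 * sampleVar z n / n * L) + 7 * R / (3 * ((n : ℝ) - 1)) * L

theorem radius_eq_bernsteinRadius (d : ℕ) (δ R : ℝ) (z : ℕ → ℝ) (n : ℕ) :
    radius d δ R z n = bernsteinRadius (Real.log (4 * d / δ)) R z n :=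
  rfl

theorem sampleVar_le {z : ℕ → ℝ} {a b : ℝ} (hz : ∀ i, z i ∈ Set.Icc a b) {n : ℕ} (hn : 2 ≤ n) :
    sampleVar z n ≤ (b - a) ^ 2 / 2 := by
  have hn₂ : (2 : ℝ) ≤ n := by exact_mod_cast hn
  have : (n : ℝ) * (n - 1) ≠ 0 := by nlinarith
  have hcard : ((Finset.univ : Finset (Fin n)).offDiag.card : ℝ) = n * (n - 1) := by
    rw [Finset.offDiag_card, Finset.card_univ, Fintype.card_fin, Nat.cast_sub (Nat.le_mul_self n),
      Nat.cast_mul]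
    ring
  have hterm (x : Fin n × Fin n) : (z x.1 - z x.2) ^ 2 / 2 ≤ (b - a) ^ 2 / 2 := by
    have h₁ := hz x.1
    have h₂ := hz x.2
    have : (z x.1 - z x.2) ^ 2 ≤ (b - a) ^ 2 :=
      sq_le_sq' (by linarith [h₁.1, h₂.2]) (by linarith [h₁.2, h₂.1])
    gcongr
  rw [sampleVar_eq_sum_offDiag, div_le_iff₀ (by nlinarith), mul_comm, ← hcard, ← nsmul_eq_mul]
  exact Finset.sum_le_card_nsmul _ _ _ fun x _ ↦ hterm x

theorem bernsteinRadius_nonneg {L R : ℝ} (hL : 0 ≤ L) (hR : 0 ≤ R) (z : ℕ → ℝ) {n : ℕ}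
    (hn : 2 ≤ n) : 0 ≤ bernsteinRadius L R z n := by
  have hn₁ : (0 : ℝ) < n - 1 := sub_pos.2 (by exact_mod_cast hn)
  unfold bernsteinRadius
  positivity

theorem bernsteinRadius_three_mul_le {L : ℝ} (hL : 0 ≤ L) (R : ℝ) (z : ℕ → ℝ) (n : ℕ) :
    bernsteinRadius (3 * L) R z n ≤ 3 * bernsteinRadius L R z n := by
  have h₀ : 0 ≤ 2 * sampleVar z n / n * L := by
    have := sampleVar_nonneg z n
    positivity
  have hsqrt : √(2 * sampleVar z n / n * (3 * L)) ≤ 3 * √(2 * sampleVar z n / n * L) := by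
    rw [Real.sqrt_le_left (by positivity), mul_pow, Real.sq_sqrt h₀]
    linarith
  unfold bernsteinRadius
  linarith

theorem bernsteinRadius_le_sqrt_add {L R : ℝ} (hL : 0 ≤ L) (hR : 0 ≤ R) (z : ℕ → ℝ) {n : ℕ}
    (hn : 2 ≤ n) : bernsteinRadius L R z n ≤ √(2 * sampleVar z n / n * L) + 5 * R * L / n := by
  have hn₂ : (2 : ℝ) ≤ n := by exact_mod_cast hn
  have hRL : 0 ≤ R * L := mul_nonneg hR hL
  have hbias : 7 * R / (3 * ((n : ℝ) - 1)) * L ≤ 5 * R * L / n := by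
    rw [div_mul_eq_mul_div, div_le_div_iff₀ (by linarith) (by linarith)]
    nlinarith
  exact add_le_add_right hbias _

theorem bernsteinRadius_le {z : ℕ → ℝ} {a b L : ℝ} (hL : 1 ≤ L) (hz : ∀ i, z i ∈ Set.Icc a b)
    {n : ℕ} (hn : 2 ≤ n) : bernsteinRadius L (b - a) z n ≤ 6 * (b - a) * L / √n := by
  set R := b - a
  have hn₂ : (2 : ℝ) ≤ n := by exact_mod_cast hn
  have hR : 0 ≤ R := sub_nonneg.2 ((hz 0).1.trans (hz 0).2)
  have : 0 < √n := Real.sqrt_pos.2 (by linarith)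
  have hsqrt_le : √n ≤ n := by rw [Real.sqrt_le_left (by linarith)]; nlinarith
  have hvar : √(2 * sampleVar z n / n * L) ≤ R * L / √n := by
    have h := sampleVar_le hz hn
    rw [Real.sqrt_le_left (by positivity), div_pow, Real.sq_sqrt (by positivity), mul_pow,
      div_mul_eq_mul_div]
    gcongr
    · linarith
    · nlinarith
  calc bernsteinRadius L R z n ≤ √(2 * sampleVar z n / n * L) + 5 * R * L / n :=
        bernsteinRadius_le_sqrt_add (by linarith) hR z hn
    _ ≤ R * L / √n + 5 * R * L / √n := by gcongr
    _ = 6 * R * L / √n := by ring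

theorem le_bernsteinRadius {z : ℕ → ℝ} {n : ℕ} {x R V L : ℝ} (hn : 2 ≤ n) (hR : 0 ≤ R)
    (hL : 0 ≤ L) (hV : 0 ≤ V) (hx : n * x ≤ √(2 * (n * V) * L) + R * L / 3)
    (hvar : √V ≤ √(sampleVar z n) + R * √(2 * L / (n - 1))) : x ≤ bernsteinRadius L R z n := by
  have hn₁ : (0 : ℝ) < n - 1 := sub_pos.2 (by exact_mod_cast hn)
  have hn₀ : (0 : ℝ) < n := by linarith
  have hfactor (v : ℝ) (hv : 0 ≤ v) : √(2 * v / n * L) = √v * √(2 * L / n) := by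
    rw [← Real.sqrt_mul hv]
    ring_nf
  have hsum : √(2 * (n * V) * L) = n * √(2 * V / n * L) := by
    rw [← Real.sqrt_sq hn₀.le, ← Real.sqrt_mul (by positivity), Real.sqrt_sq hn₀.le]
    congr 1
    field_simp
  have hsd : √(2 * V / n * L) ≤ √(2 * sampleVar z n / n * L) + R * (2 * L / (n - 1)) := by
    rw [hfactor V hV, hfactor _ (sampleVar_nonneg z n),
      ← Real.mul_self_sqrt (by positivity : 0 ≤ 2 * L / ((n : ℝ) - 1))]
    calc √V * √(2 * L / n)
        ≤ (√(sampleVar z n) + R * √(2 * L / (n - 1))) * √(2 * L / n) := by gcongr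
      _ ≤ √(sampleVar z n) * √(2 * L / n) + R * √(2 * L / (n - 1)) * √(2 * L / (n - 1)) := by
          rw [add_mul]
          gcongr
          linarith
      _ = _ := by rw [mul_assoc R]
  have hbias : R * L / 3 / n ≤ R * L / 3 / (n - 1) := by
    gcongr
    linarith
  calc x ≤ (n * √(2 * V / n * L) + R * L / 3) / n := by
        rw [le_div_iff₀ hn₀, mul_comm, ← hsum]
        exact hx
    _ = √(2 * V / n * L) + R * L / 3 / n := by field_simp
    _ ≤ √(2 * sampleVar z n / n * L) + R * (2 * L / (n - 1)) + R * L / 3 / (n - 1) := by gcongr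
    _ = bernsteinRadius L R z n := by rw [bernsteinRadius]; field_simp; ring

variable {Ω : Type*} [MeasurableSpace Ω] {μ : Measure Ω} [IsProbabilityMeasure μ]

theorem measureReal_lt_natCast_mul_sampleMean_sub {Z : ℕ → Ω → ℝ} {a b M V L : ℝ}
    (hZ : ∀ i, Measurable (Z i)) (hZab : ∀ i, ∀ᵐ ω ∂μ, Z i ω ∈ Set.Icc a b)
    (hind : iIndepFun Z μ) (hmean : ∀ i, μ[Z i] = M) (hvar : ∀ i, Var[Z i; μ] = V) (hL : 0 ≤ L)
    (n : ℕ) :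
    μ.real {ω | √(2 * (n * V) * L) + (b - a) * L / 3 < n * (sampleMean (Z · ω) n - M)}
      ≤ Real.exp (-L) := by
  have hM : M ∈ Set.Icc a b := by
    have hint : Integrable (Z 0) μ := Integrable.of_mem_Icc a b (hZ 0).aemeasurable (hZab 0)
    rw [← hmean 0]
    exact (convex_Icc a b).integral_mem isClosed_Icc (hZab 0) hint
  have h := measureReal_sqrt_add_lt_sum_sub_integral_le (R := b - a)
    (fun i ↦ memLp_of_bounded (hZab i) (hZ i).aestronglyMeasurable 2) hind
    (sub_nonneg.2 (hM.1.trans hM.2)) (fun i ↦ by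
      filter_upwards [hZab i] with ω hω
      rw [hmean]
      exact sub_le_sub hω.2 hM.1) hL (Finset.range n)
  simpa only [mul_sub, natCast_mul_sampleMean, hmean, hvar, Finset.sum_sub_distrib,
    Finset.sum_const, Finset.card_range, nsmul_eq_mul] using h

theorem measureReal_bernsteinRadius_lt_sampleMean_sub {Z : ℕ → Ω → ℝ} {a b M V L : ℝ}
    (hZ : ∀ i, Measurable (Z i)) (hZab : ∀ i, ∀ᵐ ω ∂μ, Z i ω ∈ Set.Icc a b)
    (hind : iIndepFun Z μ) (hmean : ∀ i, μ[Z i] = M) (hvar : ∀ i, Var[Z i; μ] = V) (hL : 0 ≤ L)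
    {n : ℕ} (hn : 2 ≤ n) :
    μ.real {ω | bernsteinRadius L (b - a) (Z · ω) n < sampleMean (Z · ω) n - M}
      ≤ 2 * Real.exp (-L) := by
  have hV : 0 ≤ V := hvar 0 ▸ variance_nonneg _ _
  have hab : a ≤ b := (hZab 0).exists.elim fun ω hω ↦ hω.1.trans hω.2
  set A := {ω | √(2 * (n * V) * L) + (b - a) * L / 3 < n * (sampleMean (Z · ω) n - M)}
  set B := {ω | √(sampleVar (Z · ω) n) + (b - a) * √(2 * L / (n - 1)) < √V}
  have hsub : {ω | bernsteinRadius L (b - a) (Z · ω) n < sampleMean (Z · ω) n - M} ⊆ A ∪ B := by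
    intro ω hω
    by_contra hAB
    obtain ⟨hA, hB⟩ := not_or.1 hAB
    exact not_le.2 hω
      (le_bernsteinRadius hn (sub_nonneg.2 hab) hL hV (not_lt.1 hA) (not_lt.1 hB))
  calc _ ≤ μ.real (A ∪ B) := measureReal_mono hsub
    _ ≤ μ.real A + μ.real B := measureReal_union_le _ _
    _ ≤ Real.exp (-L) + Real.exp (-L) := add_le_add
        (measureReal_lt_natCast_mul_sampleMean_sub hZ hZab hind hmean hvar hL n)
        (measureReal_sqrt_sampleVar_add_lt hZ hZab hind
          (fun i j ↦ (hmean i).trans (hmean j).symm) hvar hL hn)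
    _ = 2 * Real.exp (-L) := (two_mul _).symm

theorem measureReal_bernsteinRadius_lt_abs_sampleMean_sub {Z : ℕ → Ω → ℝ} {a b M V L : ℝ}
    (hZ : ∀ i, Measurable (Z i)) (hZab : ∀ i, ∀ᵐ ω ∂μ, Z i ω ∈ Set.Icc a b)
    (hind : iIndepFun Z μ) (hmean : ∀ i, μ[Z i] = M) (hvar : ∀ i, Var[Z i; μ] = V) (hL : 0 ≤ L)
    {n : ℕ} (hn : 2 ≤ n) :
    μ.real {ω | bernsteinRadius L (b - a) (Z · ω) n < |sampleMean (Z · ω) n - M|}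
      ≤ 3 * Real.exp (-L) := by
  have hV : 0 ≤ V := hvar 0 ▸ variance_nonneg _ _
  have hab : a ≤ b := (hZab 0).exists.elim fun ω hω ↦ hω.1.trans hω.2
  set A := {ω | √(2 * (n * V) * L) + (b - a) * L / 3 < n * (sampleMean (Z · ω) n - M)}
  set A' := {ω | √(2 * (n * V) * L) + (b - a) * L / 3 < n * (M - sampleMean (Z · ω) n)}
  set B := {ω | √(sampleVar (Z · ω) n) + (b - a) * √(2 * L / (n - 1)) < √V}
  have hA' : μ.real A' ≤ Real.exp (-L) := by
    have h := measureReal_lt_natCast_mul_sampleMean_sub (Z := fun i ω ↦ -Z i ω) (a := -b) (b := -a)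
      (M := -M) (V := V) (fun i ↦ (hZ i).neg)
      (fun i ↦ (hZab i).mono fun ω hω ↦ ⟨neg_le_neg hω.2, neg_le_neg hω.1⟩)
      (hind.comp (fun _ ↦ Neg.neg) fun _ ↦ measurable_neg)
      (fun i ↦ by rw [integral_neg, hmean]) (fun i ↦ by rw [variance_fun_neg, hvar]) hL n
    simpa only [sampleMean_neg, neg_sub_neg] using h
  have hsub : {ω | bernsteinRadius L (b - a) (Z · ω) n < |sampleMean (Z · ω) n - M|}
      ⊆ A ∪ A' ∪ B := by
    intro ω hω
    by_contra hAB
    simp only [Set.mem_union, not_or] at hAB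
    obtain ⟨⟨hA, hA'⟩, hB⟩ := hAB
    have hle {x : ℝ} := le_bernsteinRadius (z := (Z · ω)) (x := x) hn (sub_nonneg.2 hab) hL hV
    refine not_le.2 hω (abs_le.2 ⟨?_, hle (not_lt.1 hA) (not_lt.1 hB)⟩)
    linarith [hle (not_lt.1 hA') (not_lt.1 hB)]
  calc _ ≤ μ.real (A ∪ A' ∪ B) := measureReal_mono hsub
    _ ≤ μ.real A + μ.real A' + μ.real B :=
        (measureReal_union_le _ _).trans (by gcongr; exact measureReal_union_le _ _)
    _ ≤ Real.exp (-L) + Real.exp (-L) + Real.exp (-L) := add_le_add (add_le_add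
        (measureReal_lt_natCast_mul_sampleMean_sub hZ hZab hind hmean hvar hL n) hA')
        (measureReal_sqrt_sampleVar_add_lt hZ hZab hind
          (fun i j ↦ (hmean i).trans (hmean j).symm) hvar hL hn)
    _ = 3 * Real.exp (-L) := by ring

end EmpiricalBernstein

section Clip

theorem negMulLog_le_tangent {p y : ℝ} (hp : 0 < p) (hy : 0 ≤ y) :
    Real.negMulLog y ≤ Real.negMulLog p + (-Real.log p - 1) * (y - p) := by
  have h : Real.negMulLog (y / p) ≤ 1 - y / p := Real.negMulLog_le_one_sub_self (by positivity)
  calc Real.negMulLog y = y / p * Real.negMulLog p + p * Real.negMulLog (y / p) := by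
        rw [← Real.negMulLog_mul, mul_div_cancel₀ y hp.ne']
    _ ≤ y / p * Real.negMulLog p + p * (1 - y / p) := by gcongr
    _ = Real.negMulLog p + (-Real.log p - 1) * (y - p) := by
        rw [Real.negMulLog]
        field_simp
        ring

theorem negMulLog_le_negMulLog_of_mem_uIcc {p y : ℝ} (hp : 0 ≤ p)
    (hy : y ∈ Set.uIcc p (Real.exp (-1))) : Real.negMulLog p ≤ Real.negMulLog y := by
  rcases Set.mem_uIcc.1 hy with ⟨hpy, hye⟩ | ⟨hey, hyp⟩
  · rcases (hp.trans hpy).eq_or_lt with rfl | hy₀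
    · rw [hpy.antisymm hp]
    · have hlog : Real.log y ≤ -1 := (Real.log_le_iff_le_exp hy₀).2 hye
      nlinarith [negMulLog_le_tangent hy₀ hp]
  · have hy₀ : 0 < y := (Real.exp_pos _).trans_le hey
    have hlog : -1 ≤ Real.log y := (Real.le_log_iff_exp_le hy₀).2 hey
    nlinarith [negMulLog_le_tangent hy₀ hp]

theorem negMulLog_le_two_mul_sqrt {x : ℝ} (hx : 0 ≤ x) : Real.negMulLog x ≤ 2 * √x := by
  have hs : Real.negMulLog √x ≤ 1 - √x := Real.negMulLog_le_one_sub_self (Real.sqrt_nonneg x)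
  nth_rw 1 [← Real.mul_self_sqrt hx]
  rw [Real.negMulLog_mul]
  nlinarith [Real.sqrt_nonneg x]

theorem clip_of_le_exp {p ε : ℝ} (hε : 0 ≤ ε) (hp : p ≤ Real.exp (-1)) :
    clip p ε = min (p + ε) (Real.exp (-1)) := by
  rw [clip, abs_of_nonneg (sub_nonneg.2 hp)]
  split_ifs with h
  · rw [min_eq_left (by linarith)]
    rcases hp.eq_or_lt with rfl | hp
    · rw [sub_self, zero_div, zero_mul]
      linarith
    · rw [div_self (sub_pos.2 hp).ne', one_mul]
  · rw [min_eq_right (by linarith)]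

theorem clip_of_exp_lt {p ε : ℝ} (hp : Real.exp (-1) < p) :
    clip p ε = max (p - ε) (Real.exp (-1)) := by
  have hneg : Real.exp (-1) - p < 0 := sub_neg.2 hp
  rw [clip, abs_of_neg hneg]
  split_ifs with h
  · rw [max_eq_left (by linarith), div_neg, div_self hneg.ne]
    ring
  · rw [max_eq_right (by linarith)]

theorem clip_mem_uIcc {p r ε : ℝ} (h : |r - p| ≤ ε) :
    clip r ε ∈ Set.uIcc p (Real.exp (-1)) := by
  have hε : 0 ≤ ε := (abs_nonneg _).trans h
  obtain ⟨hlow, hupp⟩ := abs_le.1 h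
  rcases le_or_gt r (Real.exp (-1)) with hr | hr
  · rw [clip_of_le_exp hε hr]
    rcases le_total p (Real.exp (-1)) with hp | hp
    · exact Set.mem_uIcc_of_le (le_min (by linarith) hp) (min_le_right _ _)
    · rw [min_eq_right (by linarith)]
      exact Set.right_mem_uIcc
  · rw [clip_of_exp_lt hr]
    rcases le_total p (Real.exp (-1)) with hp | hp
    · rw [max_eq_right (by linarith)]
      exact Set.right_mem_uIcc
    · exact Set.mem_uIcc_of_ge (le_max_right _ _) (max_le (by linarith) hp)

theorem clip_mem_Icc {p ε : ℝ} (hε : 0 ≤ ε) (hp : p ∈ Set.Icc (0 : ℝ) 1) :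
    clip p ε ∈ Set.Icc (0 : ℝ) 1 :=
  Set.uIcc_subset_Icc hp ⟨(Real.exp_pos _).le, Real.exp_le_one_iff.2 (by norm_num)⟩
    (clip_mem_uIcc (by simpa using hε))

theorem abs_clip_sub_le {p ε : ℝ} (hε : 0 ≤ ε) : |clip p ε - p| ≤ ε := by
  rw [abs_le]
  rcases le_or_gt p (Real.exp (-1)) with hp | hp
  · rw [clip_of_le_exp hε hp]
    constructor
    · linarith [le_min (le_add_of_nonneg_right hε) hp]
    · linarith [min_le_left (p + ε) (Real.exp (-1))]
  · rw [clip_of_exp_lt hp]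
    constructor
    · linarith [le_max_left (p - ε) (Real.exp (-1))]
    · linarith [max_le (sub_le_self p hε) hp.le]

theorem negMulLog_le_negMulLog_clip {p r ε : ℝ} (hp : 0 ≤ p) (h : |r - p| ≤ ε) :
    Real.negMulLog p ≤ Real.negMulLog (clip r ε) :=
  negMulLog_le_negMulLog_of_mem_uIcc hp (clip_mem_uIcc h)

end Clip

section Score

variable {d : ℕ}

theorem pos_of_mem_stdSimplex {z : Fin d → ℝ} (hz : z ∈ stdSimplex ℝ (Fin d)) : 0 < d := by
  rcases d.eq_zero_or_pos with rfl | hd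
  · simpa using hz.2
  · exact hd

theorem entropy_nonneg {z : Fin d → ℝ} (hz : z ∈ stdSimplex ℝ (Fin d)) : 0 ≤ entropy z :=
  Finset.sum_nonneg fun j _ ↦ Real.negMulLog_nonneg (hz.1 j) (mem_Icc_of_mem_stdSimplex hz j).2

theorem entropy_le_log {z : Fin d → ℝ} (hz : z ∈ stdSimplex ℝ (Fin d)) :
    entropy z ≤ Real.log d := by
  have hd : (0 : ℝ) < d := by exact_mod_cast pos_of_mem_stdSimplex hz
  calc entropy z ≤ ∑ j, (Real.negMulLog (d : ℝ)⁻¹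
        + (-Real.log (d : ℝ)⁻¹ - 1) * (z j - (d : ℝ)⁻¹)) :=
        Finset.sum_le_sum fun j _ ↦ negMulLog_le_tangent (by positivity) (hz.1 j)
    _ = Real.log d := by
        rw [Finset.sum_add_distrib, ← Finset.mul_sum, Finset.sum_sub_distrib, hz.2]
        simp [Real.negMulLog, hd.ne']

theorem entropy_mem_Icc {z : Fin d → ℝ} (hz : z ∈ stdSimplex ℝ (Fin d)) :
    entropy z ∈ Set.Icc 0 (Real.log d) :=
  ⟨entropy_nonneg hz, entropy_le_log hz⟩

theorem measurable_entropy : Measurable (entropy : (Fin d → ℝ) → ℝ) :=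
  Finset.measurable_sum _ fun j _ ↦
    Real.continuous_negMulLog.measurable.comp (measurable_pi_apply j)

variable {𝒳 : Type*} [MeasurableSpace 𝒳] {q : 𝒳 → Fin d → ℝ}

theorem integrable_coord (hq_meas : Measurable q) (hq : ∀ x, q x ∈ stdSimplex ℝ (Fin d))
    (p : Measure 𝒳) [IsFiniteMeasure p] (j : Fin d) : Integrable (fun x ↦ q x j) p :=
  Integrable.of_mem_Icc 0 1 (measurable_pi_iff.1 hq_meas j).aemeasurable
    (ae_of_all _ fun x ↦ mem_Icc_of_mem_stdSimplex (hq x) j)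

theorem integrable_entropy (hq_meas : Measurable q) (hq : ∀ x, q x ∈ stdSimplex ℝ (Fin d))
    (p : Measure 𝒳) [IsFiniteMeasure p] : Integrable (fun x ↦ entropy (q x)) p :=
  Integrable.of_mem_Icc 0 (Real.log d) (measurable_entropy.comp hq_meas).aemeasurable
    (ae_of_all _ fun x ↦ entropy_mem_Icc (hq x))

theorem marginal_mem_stdSimplex (hq_meas : Measurable q) (hq : ∀ x, q x ∈ stdSimplex ℝ (Fin d))
    (p : Measure 𝒳) [IsProbabilityMeasure p] : marginal q p ∈ stdSimplex ℝ (Fin d) := by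
  refine ⟨fun j ↦ integral_nonneg fun x ↦ (hq x).1 j, ?_⟩
  simp only [marginal]
  rw [← integral_finsetSum _ fun j _ ↦ integrable_coord hq_meas hq p j]
  simp [fun x ↦ (hq x).2]

theorem ae_eq_zero_of_marginal_eq_zero (hq_meas : Measurable q)
    (hq : ∀ x, q x ∈ stdSimplex ℝ (Fin d)) (p : Measure 𝒳) [IsFiniteMeasure p] :
    ∀ᵐ x ∂p, ∀ j, marginal q p j = 0 → q x j = 0 := by
  rw [ae_all_iff]
  intro j
  by_cases hj : marginal q p j = 0
  · filter_upwards [(integral_eq_zero_iff_of_nonneg (fun x ↦ (hq x).1 j)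
      (integrable_coord hq_meas hq p j)).1 hj] with x hx _ using hx
  · exact ae_of_all _ fun x h ↦ absurd h hj

theorem kl_eq_sum_mul_neg_log_sub_entropy {r s : Fin d → ℝ} (hrs : ∀ j, s j = 0 → r j = 0) :
    kl r s = (∑ j, r j * -Real.log (s j)) - entropy r := by
  rw [kl, entropy, ← Finset.sum_sub_distrib]
  refine Finset.sum_congr rfl fun j _ ↦ ?_
  by_cases hr : r j = 0
  · simp [hr]
  · rw [Real.log_div hr fun hs ↦ hr (hrs j hs), Real.negMulLog]
    ring

theorem integral_kl (hq_meas : Measurable q) (hq : ∀ x, q x ∈ stdSimplex ℝ (Fin d))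
    (p : Measure 𝒳) [IsFiniteMeasure p] :
    ∫ x, kl (q x) (marginal q p) ∂p = entropy (marginal q p) - ∫ x, entropy (q x) ∂p := by
  have hint (j : Fin d) : Integrable (fun x ↦ q x j * -Real.log (marginal q p j)) p :=
    (integrable_coord hq_meas hq p j).mul_const _
  have hkl : (fun x ↦ kl (q x) (marginal q p))
      =ᵐ[p] fun x ↦ (∑ j, q x j * -Real.log (marginal q p j)) - entropy (q x) := by
    filter_upwards [ae_eq_zero_of_marginal_eq_zero hq_meas hq p] with x hx
    exact kl_eq_sum_mul_neg_log_sub_entropy hx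
  rw [integral_congr_ae hkl, integral_sub (integrable_finsetSum _ fun j _ ↦ hint j)
    (integrable_entropy hq_meas hq p), integral_finsetSum _ fun j _ ↦ hint j]
  congr 1
  refine Finset.sum_congr rfl fun j _ ↦ ?_
  rw [integral_mul_const, Real.negMulLog, ← marginal]
  ring

theorem inceptionScore_eq (hq_meas : Measurable q) (hq : ∀ x, q x ∈ stdSimplex ℝ (Fin d))
    (p : Measure 𝒳) [IsFiniteMeasure p] :
    inceptionScore q p = Real.exp (entropy (marginal q p) - ∫ x, entropy (q x) ∂p) := by
  rw [inceptionScore, integral_kl hq_meas hq p]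

theorem inceptionScore_pos (q : 𝒳 → Fin d → ℝ) (p : Measure 𝒳) : 0 < inceptionScore q p :=
  Real.exp_pos _

theorem inceptionScore_le (hq_meas : Measurable q) (hq : ∀ x, q x ∈ stdSimplex ℝ (Fin d))
    (p : Measure 𝒳) [IsProbabilityMeasure p] : inceptionScore q p ≤ d := by
  have hp := marginal_mem_stdSimplex hq_meas hq p
  have hint : 0 ≤ ∫ x, entropy (q x) ∂p := integral_nonneg fun x ↦ entropy_nonneg (hq x)
  rw [inceptionScore_eq hq_meas hq p,
    ← Real.le_log_iff_exp_le (by exact_mod_cast pos_of_mem_stdSimplex hp)]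
  linarith [entropy_le_log hp]

theorem inceptionScore_eq_one {q : 𝒳 → Fin 1 → ℝ} (hq : ∀ x, q x ∈ stdSimplex ℝ (Fin 1))
    (p : Measure 𝒳) [IsProbabilityMeasure p] : inceptionScore q p = 1 := by
  have hq₁ (x : 𝒳) (j : Fin 1) : q x j = 1 := by
    simpa [Subsingleton.elim j 0] using (hq x).2
  simp [inceptionScore, kl, marginal, hq₁]

end Score

section Optimism

variable {𝒳 : Type*} [MeasurableSpace 𝒳] {d : ℕ} {q : 𝒳 → Fin d → ℝ} {p : Measure 𝒳}

/-- The first `n` terms of `x` estimate each class probability of a model with distribution `p`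
within its Bernstein radius, and do not overestimate the mean entropy by more than its radius.
This is what makes the optimistic score an upper bound of the true one. -/
structure Optimistic (q : 𝒳 → Fin d → ℝ) (p : Measure 𝒳) (L : ℝ) (x : ℕ → 𝒳) (n : ℕ) : Prop where
  abs_sub_marginal_le (j : Fin d) :
    |sampleMean (fun i ↦ q (x i) j) n - marginal q p j|
      ≤ bernsteinRadius L 1 (fun i ↦ q (x i) j) n
  sub_integral_entropy_le :
    sampleMean (fun i ↦ entropy (q (x i))) n - ∫ y, entropy (q y) ∂p
      ≤ bernsteinRadius L (Real.log d) (fun i ↦ entropy (q (x i))) n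

/-- The estimates of a model are moreover not too low, so that its optimistic score is close to
the true one. -/
structure Accurate (q : 𝒳 → Fin d → ℝ) (p : Measure 𝒳) (L : ℝ) (x : ℕ → 𝒳) (n : ℕ) : Prop
    extends Optimistic q p L x n where
  integral_entropy_sub_le :
    ∫ y, entropy (q y) ∂p - sampleMean (fun i ↦ entropy (q (x i))) n
      ≤ bernsteinRadius L (Real.log d) (fun i ↦ entropy (q (x i))) n

theorem inceptionScore_le_optimisticIS [IsProbabilityMeasure p] (hq_meas : Measurable q)
    (hq : ∀ x, q x ∈ stdSimplex ℝ (Fin d)) {δ : ℝ} {x : ℕ → 𝒳} {n : ℕ}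
    (h : 2 ≤ n → Optimistic q p (Real.log (4 * d / δ)) x n) :
    (inceptionScore q p : EReal) ≤ optimisticIS q δ x n := by
  rw [optimisticIS, inceptionScore_eq hq_meas hq p]
  split_ifs with hn
  · exact le_top
  · obtain ⟨hcls, hent⟩ := h (by lia)
    have hmarginal : entropy (marginal q p) ≤ entropy (optimisticMarginal q δ x n) :=
      Finset.sum_le_sum fun j _ ↦ negMulLog_le_negMulLog_clip
        ((marginal_mem_stdSimplex hq_meas hq p).1 j) (hcls j)
    rw [EReal.coe_le_coe_iff, Real.exp_le_exp, radius_eq_bernsteinRadius]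
    linarith

theorem sampleMean_mem_Icc {z : ℕ → ℝ} {a b : ℝ} (hz : ∀ i, z i ∈ Set.Icc a b) {n : ℕ}
    (hn : 0 < n) : sampleMean z n ∈ Set.Icc a b := by
  have hn₀ : (0 : ℝ) < n := by exact_mod_cast hn
  rw [sampleMean, Set.mem_Icc, le_div_iff₀' hn₀, div_le_iff₀' hn₀]
  constructor
  · simpa using Finset.card_nsmul_le_sum (Finset.range n) z a fun i _ ↦ (hz i).1
  · simpa using Finset.sum_le_card_nsmul (Finset.range n) z b fun i _ ↦ (hz i).2

theorem negMulLog_clip_le_of_pos {P m L : ℝ} (hP : 0 < P) (hm : |deriv Real.negMulLog P| ≤ m)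
    (hL : 1 ≤ L) {z : ℕ → ℝ} (hz : ∀ i, z i ∈ Set.Icc (0 : ℝ) 1) {n : ℕ} (hn : 2 ≤ n)
    (hmean : |sampleMean z n - P| ≤ bernsteinRadius (3 * L) 1 z n) :
    Real.negMulLog (clip (sampleMean z n) (bernsteinRadius L 1 z n))
      ≤ Real.negMulLog P + 24 * m * L / √n := by
  set r := bernsteinRadius L 1 z n
  set y := clip (sampleMean z n) r
  have hr₀ : 0 ≤ r := bernsteinRadius_nonneg (by linarith) zero_le_one z hn
  have hr : r ≤ 6 * 1 * L / √n := by simpa using bernsteinRadius_le hL hz hn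
  have hy : 0 ≤ y := (clip_mem_Icc hr₀ (sampleMean_mem_Icc hz (by lia))).1
  have hdist : |y - P| ≤ 4 * r := calc
    |y - P| ≤ |y - sampleMean z n| + |sampleMean z n - P| := abs_sub_le _ _ _
    _ ≤ r + 3 * r := add_le_add (abs_clip_sub_le hr₀)
        (hmean.trans (bernsteinRadius_three_mul_le (by linarith) 1 z n))
    _ = 4 * r := by ring
  have hm₀ : 0 ≤ m := (abs_nonneg _).trans hm
  calc Real.negMulLog y ≤ Real.negMulLog P + deriv Real.negMulLog P * (y - P) := by
        rw [Real.deriv_negMulLog hP.ne']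
        exact negMulLog_le_tangent hP hy
    _ ≤ Real.negMulLog P + |deriv Real.negMulLog P| * |y - P| := by
        rw [← abs_mul]
        gcongr
        exact le_abs_self _
    _ ≤ Real.negMulLog P + m * (4 * (6 * 1 * L / √n)) := by
        gcongr
        exact hdist.trans (by gcongr)
    _ = Real.negMulLog P + 24 * m * L / √n := by ring

-- At `0` the derivative of `- x log x` is infinite, but there the sample variance vanishes, so
-- that the radius is of order `1 / n`, and `- x log x ≤ 2 √x` gives `1 / √n` again.
theorem negMulLog_clip_le_of_eq_zero {L : ℝ} (hL : 1 ≤ L) {z : ℕ → ℝ} (hz : ∀ i, z i = 0)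
    {n : ℕ} (hn : 2 ≤ n) :
    Real.negMulLog (clip (sampleMean z n) (bernsteinRadius L 1 z n)) ≤ 5 * L / √n := by
  have hmean : sampleMean z n = 0 := by simp [sampleMean, hz]
  have hvar : sampleVar z n = 0 := by simp [sampleVar, hz]
  rw [hmean]
  set r := bernsteinRadius L 1 z n
  have hr₀ : 0 ≤ r := bernsteinRadius_nonneg (by linarith) zero_le_one z hn
  have hr : r ≤ 5 * L / n := by
    simpa [hvar] using bernsteinRadius_le_sqrt_add (by linarith : 0 ≤ L) zero_le_one z hn
  have hclip₀ : 0 ≤ clip 0 r := (clip_mem_Icc hr₀ (by simp)).1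
  have hclip : clip 0 r ≤ r := by simpa using (le_abs_self _).trans (abs_clip_sub_le (p := 0) hr₀)
  calc Real.negMulLog (clip 0 r) ≤ 2 * √(clip 0 r) := negMulLog_le_two_mul_sqrt hclip₀
    _ ≤ 2 * √((5 / 2 * L) ^ 2 / n) := by
        gcongr
        refine hclip.trans (hr.trans ?_)
        gcongr
        nlinarith
    _ = 5 * L / √n := by
        rw [Real.sqrt_div (by positivity), Real.sqrt_sq (by positivity)]
        ring

theorem entropy_optimisticMarginal_le (hq_meas : Measurable q)
    (hq : ∀ x, q x ∈ stdSimplex ℝ (Fin d)) [IsProbabilityMeasure p] {m δ : ℝ} (hm₀ : 0 ≤ m)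
    (hm : ∀ j, 0 < marginal q p j → |deriv Real.negMulLog (marginal q p j)| ≤ m)
    (hδ : 1 ≤ Real.log (4 * d / δ)) {x : ℕ → 𝒳} {n : ℕ} (hn : 2 ≤ n)
    (hacc : ∀ j, |sampleMean (fun i ↦ q (x i) j) n - marginal q p j|
      ≤ bernsteinRadius (3 * Real.log (4 * d / δ)) 1 (fun i ↦ q (x i) j) n)
    (hzero : ∀ i j, marginal q p j = 0 → q (x i) j = 0) :
    entropy (optimisticMarginal q δ x n)
      ≤ entropy (marginal q p) + d * ((24 * m + 5) * Real.log (4 * d / δ) / √n) := by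
  set L := Real.log (4 * d / δ)
  calc entropy (optimisticMarginal q δ x n)
      ≤ ∑ j, (Real.negMulLog (marginal q p j) + (24 * m + 5) * L / √n) := by
        refine Finset.sum_le_sum fun j _ ↦ ?_
        rw [optimisticMarginal, radius_eq_bernsteinRadius]
        rcases ((marginal_mem_stdSimplex hq_meas hq p).1 j).eq_or_lt with hj | hj
        · refine (negMulLog_clip_le_of_eq_zero hδ (fun i ↦ hzero i j hj.symm) hn).trans ?_
          rw [← hj, Real.negMulLog_zero, zero_add]
          gcongr
          linarith
        · refine (negMulLog_clip_le_of_pos hj (hm j hj) hδ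
            (fun i ↦ mem_Icc_of_mem_stdSimplex (hq (x i)) j) hn (hacc j)).trans ?_
          gcongr
          linarith
    _ = entropy (marginal q p) + d * ((24 * m + 5) * L / √n) := by
        rw [Finset.sum_add_distrib, Finset.sum_const, Finset.card_univ, Fintype.card_fin,
          nsmul_eq_mul, entropy]

theorem optimisticIS_le [IsProbabilityMeasure p] (hq_meas : Measurable q)
    (hq : ∀ x, q x ∈ stdSimplex ℝ (Fin d)) {m δ : ℝ} (hm₀ : 0 ≤ m)
    (hm : ∀ j, 0 < marginal q p j → |deriv Real.negMulLog (marginal q p j)| ≤ m)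
    (hδ : 1 ≤ Real.log (4 * d / δ)) {x : ℕ → 𝒳} {n : ℕ} (hn : 2 ≤ n)
    (hacc : Accurate q p (3 * Real.log (4 * d / δ)) x n)
    (hzero : ∀ i j, marginal q p j = 0 → q (x i) j = 0) :
    optimisticIS q δ x n ≤ ((inceptionScore q p * Real.exp
      ((d * (24 * m + 5) + 24 * Real.log d) * Real.log (4 * d / δ) / √n) : ℝ) : EReal) := by
  set L := Real.log (4 * d / δ)
  have hmarginal := entropy_optimisticMarginal_le hq_meas hq hm₀ hm hδ hn hacc.abs_sub_marginal_le
    hzero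
  have hent := hacc.integral_entropy_sub_le.trans
    (bernsteinRadius_three_mul_le (by linarith) _ _ _)
  have hradius : bernsteinRadius L (Real.log d) (fun i ↦ entropy (q (x i))) n
      ≤ 6 * Real.log d * L / √n := by
    simpa using bernsteinRadius_le hδ (fun i ↦ entropy_mem_Icc (hq (x i))) hn
  rw [optimisticIS, if_neg (by lia), EReal.coe_le_coe_iff, inceptionScore_eq hq_meas hq p,
    ← Real.exp_add, Real.exp_le_exp, radius_eq_bernsteinRadius]
  have hsplit : (d * (24 * m + 5) + 24 * Real.log d) * L / √n
      = d * ((24 * m + 5) * L / √n) + 4 * (6 * Real.log d * L / √n) := by ring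
  linarith

end Optimism

section Counting

variable {G : ℕ}

theorem visits_succ (a : ℕ → Fin G) (T : ℕ) (g : Fin G) :
    visits a (T + 1) g = visits a T g + if a T = g then 1 else 0 := by
  rw [visits, visits, Finset.range_add_one, Finset.filter_insert]
  split_ifs with h
  · rw [Finset.card_insert_of_notMem (by simp)]
  · rw [add_zero]

theorem visits_le (a : ℕ → Fin G) (t : ℕ) (g : Fin G) : visits a t g ≤ t :=
  (Finset.card_filter_le _ _).trans (by simp)

-- The successive picks of a model `g` occur when it has been visited `0, 1, 2, …` times.
theorem sum_visits {M : Type*} [AddCommMonoid M] (a : ℕ → Fin G) (w : ℕ → M) (T : ℕ) :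
    ∑ t ∈ Finset.range T, w (visits a t (a t))
      = ∑ g, ∑ v ∈ Finset.range (visits a T g), w v := by
  induction T with
  | zero => simp [visits]
  | succ T ih =>
    have hsucc (g : Fin G) : ∑ v ∈ Finset.range (visits a (T + 1) g), w v
        = ∑ v ∈ Finset.range (visits a T g), w v
          + if a T = g then w (visits a T g) else 0 := by
      rw [visits_succ]
      split_ifs
      · rw [Finset.sum_range_succ]
      · rw [add_zero, add_zero]
    simp only [Finset.sum_range_succ, ih, hsucc, Finset.sum_add_distrib, Finset.sum_ite_eq,
      Finset.mem_univ, if_true]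

theorem sum_visits_eq (a : ℕ → Fin G) (T : ℕ) : ∑ g, visits a T g = T := by
  simpa using (sum_visits a (fun _ ↦ (1 : ℕ)) T).symm

theorem sum_one_div_sqrt_succ_le (N : ℕ) :
    ∑ v ∈ Finset.range N, 1 / √((v : ℝ) + 1) ≤ 2 * √N := by
  induction N with
  | zero => simp
  | succ N ih =>
    have hpos : 0 < √((N : ℝ) + 1) := Real.sqrt_pos.2 (by positivity)
    have hsucc : √((N : ℝ) + 1) ^ 2 = N + 1 := Real.sq_sqrt (by positivity)
    have hN : √(N : ℝ) ^ 2 = N := Real.sq_sqrt N.cast_nonneg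
    have hstep : 1 / √((N : ℝ) + 1) ≤ 2 * √((N : ℝ) + 1) - 2 * √N := by
      rw [div_le_iff₀ hpos]
      nlinarith [sq_nonneg (√((N : ℝ) + 1) - √N)]
    rw [Finset.sum_range_succ, Nat.cast_succ]
    linarith

theorem sum_one_div_sqrt_visits_le (a : ℕ → Fin G) (T : ℕ) :
    ∑ t ∈ Finset.range T, 1 / √((visits a t (a t) : ℝ) + 1) ≤ 2 * √(G * T) := by
  have hcauchy : (∑ g, √(visits a T g : ℝ)) ^ 2 ≤ G * T := by
    have h := sq_sum_le_card_mul_sum_sq (s := Finset.univ) (f := fun g ↦ √(visits a T g : ℝ))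
    simpa [Real.sq_sqrt, ← Nat.cast_sum, sum_visits_eq] using h
  calc ∑ t ∈ Finset.range T, 1 / √((visits a t (a t) : ℝ) + 1)
      = ∑ g, ∑ v ∈ Finset.range (visits a T g), 1 / √((v : ℝ) + 1) :=
        sum_visits a (fun v ↦ 1 / √((v : ℝ) + 1)) T
    _ ≤ ∑ g, 2 * √(visits a T g : ℝ) := Finset.sum_le_sum fun g _ ↦ sum_one_div_sqrt_succ_le _
    _ = 2 * ∑ g, √(visits a T g : ℝ) := by rw [Finset.mul_sum]
    _ ≤ 2 * √(G * T) := by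
        gcongr
        exact Real.le_sqrt_of_sq_le hcauchy

end Counting

section Deterministic

variable {𝒳 : Type*} [MeasurableSpace 𝒳] {d G : ℕ} {q : 𝒳 → Fin d → ℝ} {p : Fin G → Measure 𝒳}

theorem slope_nonneg (q : 𝒳 → Fin d → ℝ) (p : Fin G → Measure 𝒳) : 0 ≤ slope q p :=
  Real.sSup_nonneg (by rintro r ⟨g, j, -, rfl⟩; exact abs_nonneg _)

theorem abs_deriv_negMulLog_le_slope {g : Fin G} {j : Fin d} (h : 0 < marginal q (p g) j) :
    |deriv Real.negMulLog (marginal q (p g) j)| ≤ slope q p := by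
  refine le_csSup (Set.Finite.bddAbove ?_) ⟨g, j, h, rfl⟩
  refine (Set.finite_range fun s : Fin G × Fin d ↦
    |deriv Real.negMulLog (marginal q (p s.1) s.2)|).subset ?_
  rintro r ⟨g, j, -, rfl⟩
  exact ⟨(g, j), rfl⟩

theorem regret_le_mul [∀ g, IsProbabilityMeasure (p g)] (hq_meas : Measurable q)
    (hq : ∀ x, q x ∈ stdSimplex ℝ (Fin d)) (T : ℕ) (a : ℕ → Fin G) :
    regret q p T a ≤ d * T := by
  have : Nonempty (Fin G) := ⟨a 0⟩
  calc regret q p T a ≤ ∑ _t ∈ Finset.range T, (d : ℝ) :=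
        Finset.sum_le_sum fun t _ ↦ (sub_le_self _ (inceptionScore_pos q (p (a t))).le).trans
          (ciSup_le fun g ↦ inceptionScore_le hq_meas hq (p g))
    _ = d * T := by simp [mul_comm]

theorem regret_eq_zero {q : 𝒳 → Fin 1 → ℝ} (hq : ∀ x, q x ∈ stdSimplex ℝ (Fin 1))
    [∀ g, IsProbabilityMeasure (p g)] (T : ℕ) (a : ℕ → Fin G) : regret q p T a = 0 := by
  have : Nonempty (Fin G) := ⟨a 0⟩
  simp [regret, inceptionScore_eq_one hq]

/-- The numbers of samples in `[2, ∞)` that a model can have when one of the steps `0, …, T - 1`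
of batch size `b` begins. -/
def sampleSizes (b T : ℕ) : Finset ℕ :=
  {n ∈ (Finset.Ico 1 T).image (b * ·) | 2 ≤ n}

theorem two_le_of_mem_sampleSizes {b T n : ℕ} (hn : n ∈ sampleSizes b T) : 2 ≤ n :=
  (Finset.mem_filter.1 hn).2

theorem card_sampleSizes_le (b T : ℕ) : (sampleSizes b T).card ≤ T - 1 :=
  (Finset.card_filter_le _ _).trans (Finset.card_image_le.trans (Nat.card_Ico 1 T).le)

theorem mul_visits_mem_sampleSizes {b T t : ℕ} (ht : t < T) {a : ℕ → Fin G} {g : Fin G}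
    (hn : 2 ≤ b * visits a t g) : b * visits a t g ∈ sampleSizes b T := by
  have hpos : 1 ≤ visits a t g := Nat.pos_of_mul_pos_left (by lia : 0 < b * visits a t g)
  exact Finset.mem_filter.2 ⟨Finset.mem_image_of_mem _
    (Finset.mem_Ico.2 ⟨hpos, (visits_le a t g).trans_lt ht⟩), hn⟩

/-- The event on which the regret bound holds. Optimism, which is lost with the larger
probability, is only needed for the best model `g₀`; the scores of all the other models only need
to be close to the true ones. -/
structure GoodSamples (q : 𝒳 → Fin d → ℝ) (p : Fin G → Measure 𝒳) (g₀ : Fin G) (L : ℝ)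
    (N : Finset ℕ) (x : Fin G → ℕ → 𝒳) : Prop where
  optimistic : ∀ n ∈ N, Optimistic q (p g₀) L (x g₀) n
  accurate : ∀ g, ∀ n ∈ N, Accurate q (p g) (3 * L) (x g) n
  eq_zero : ∀ g i j, marginal q (p g) j = 0 → q (x g i) j = 0

theorem five_eighths_le_log (hd : 2 ≤ d) : (5 : ℝ) / 8 ≤ Real.log d := calc
  (5 : ℝ) / 8 ≤ Real.log 2 := by linarith [Real.log_two_gt_d9]
  _ ≤ Real.log d := Real.log_le_log two_pos (by exact_mod_cast hd)

/-- The coefficient of `√(G T)` in the regret bound, up to a numerical factor. -/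
def rate (d : ℕ) (L m : ℝ) : ℝ :=
  d ^ 2 * L * (d * m + Real.log d)

theorem natCast_le_rate {L m : ℝ} (hd : 2 ≤ d) (hL : 1 ≤ L) (hm : 0 ≤ m) :
    (d : ℝ) ≤ rate d L m := by
  have hd₂ : (2 : ℝ) ≤ d := by exact_mod_cast hd
  have hlog := five_eighths_le_log hd
  calc (d : ℝ) ≤ d * (2 * 1 * (0 + 5 / 8)) := by linarith
    _ ≤ d * (d * L * (d * m + Real.log d)) := by gcongr; positivity
    _ = rate d L m := by rw [rate]; ring

theorem mul_width_le_rate {L m : ℝ} (hd : 2 ≤ d) (hL : 0 ≤ L) (hm : 0 ≤ m) :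
    d * ((d * (24 * m + 5) + 24 * Real.log d) * L) ≤ 32 * rate d L m := by
  have hd₂ : (2 : ℝ) ≤ d := by exact_mod_cast hd
  have hlog := five_eighths_le_log hd
  have hwidth : d * (24 * m + 5) + 24 * Real.log d ≤ 32 * (d * (d * m + Real.log d)) := by
    have : 0 ≤ d * m := by positivity
    nlinarith
  calc d * ((d * (24 * m + 5) + 24 * Real.log d) * L)
      ≤ d * (32 * (d * (d * m + Real.log d)) * L) := by gcongr
    _ = 32 * rate d L m := by rw [rate]; ring

theorem sub_le_mul_of_le_mul_exp {x y w : ℝ} (hx : 0 ≤ x) (h : x ≤ y * Real.exp w) :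
    x - y ≤ x * w := by
  have hy : x * Real.exp (-w) ≤ y := by
    rwa [Real.exp_neg, ← div_eq_mul_inv, div_le_iff₀ (Real.exp_pos w)]
  nlinarith [Real.one_sub_le_exp_neg w]

variable {δ : ℝ} {b T : ℕ} {x : Fin G → ℕ → 𝒳} {a : ℕ → Fin G} {g₀ : Fin G}

theorem step_regret_le_of_two_le [∀ g, IsProbabilityMeasure (p g)] (hq_meas : Measurable q)
    (hq : ∀ x, q x ∈ stdSimplex ℝ (Fin d)) (hd : 2 ≤ d)
    (hδ : 1 ≤ Real.log (4 * d / (δ / T))) (hrun : IsRun q δ b T x a)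
    (hx : GoodSamples q p g₀ (Real.log (4 * d / (δ / T))) (sampleSizes b T) x) {t : ℕ} (ht : t < T)
    (hn : 2 ≤ b * visits a t (a t)) :
    inceptionScore q (p g₀) - inceptionScore q (p (a t))
      ≤ 32 * rate d (Real.log (4 * d / (δ / T))) (slope q p) / √(b * visits a t (a t) : ℕ) := by
  set L := Real.log (4 * d / (δ / T))
  set n := b * visits a t (a t)
  set width := d * (24 * slope q p + 5) + 24 * Real.log d
  have hm := slope_nonneg q p
  have hL : 0 ≤ L := zero_le_one.trans hδ
  have : 0 ≤ width := by positivity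
  have hoptimistic : (inceptionScore q (p g₀) : EReal)
      ≤ optimisticIS q (δ / T) (x g₀) (b * visits a t g₀) :=
    inceptionScore_le_optimisticIS hq_meas hq fun h ↦
      hx.optimistic _ (mul_visits_mem_sampleSizes ht h)
  have haccurate : optimisticIS q (δ / T) (x (a t)) n
      ≤ ((inceptionScore q (p (a t)) * Real.exp (width * L / √n) : ℝ) : EReal) :=
    optimisticIS_le hq_meas hq hm (fun j ↦ abs_deriv_negMulLog_le_slope) hδ hn
      (hx.accurate _ _ (mul_visits_mem_sampleSizes ht hn)) (hx.eq_zero _)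
  have hle : inceptionScore q (p g₀) ≤ inceptionScore q (p (a t)) * Real.exp (width * L / √n) :=
    EReal.coe_le_coe_iff.1 (hoptimistic.trans ((hrun t ht g₀).trans haccurate))
  calc inceptionScore q (p g₀) - inceptionScore q (p (a t))
      ≤ inceptionScore q (p g₀) * (width * L / √n) :=
        sub_le_mul_of_le_mul_exp (inceptionScore_pos q _).le hle
    _ ≤ d * (width * L / √n) := by
        gcongr
        exact inceptionScore_le hq_meas hq _
    _ = d * (width * L) / √n := by ring
    _ ≤ 32 * rate d L (slope q p) / √n :=
        div_le_div_of_nonneg_right (mul_width_le_rate hd hL hm) (Real.sqrt_nonneg _)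

theorem step_regret_le [∀ g, IsProbabilityMeasure (p g)] (hq_meas : Measurable q)
    (hq : ∀ x, q x ∈ stdSimplex ℝ (Fin d)) (hd : 2 ≤ d) (hb : 1 ≤ b)
    (hδ : 1 ≤ Real.log (4 * d / (δ / T))) (hrun : IsRun q δ b T x a)
    (hx : GoodSamples q p g₀ (Real.log (4 * d / (δ / T))) (sampleSizes b T) x) {t : ℕ}
    (ht : t < T) :
    inceptionScore q (p g₀) - inceptionScore q (p (a t))
      ≤ 64 * rate d (Real.log (4 * d / (δ / T))) (slope q p)
        * (1 / √((visits a t (a t) : ℝ) + 1)) := by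
  set r := rate d (Real.log (4 * d / (δ / T))) (slope q p)
  set v := visits a t (a t)
  have hr : d ≤ r := natCast_le_rate hd hδ (slope_nonneg q p)
  have hr₀ : 0 ≤ r := d.cast_nonneg.trans hr
  have : 0 < √((v : ℝ) + 1) := Real.sqrt_pos.2 (by positivity)
  rw [mul_one_div]
  rcases Nat.lt_or_ge (b * v) 2 with hn | hn
  · have hv : v ≤ 1 := by nlinarith
    have hsqrt_le : √((v : ℝ) + 1) ≤ 2 := by
      have : (v : ℝ) ≤ 1 := by exact_mod_cast hv
      rw [Real.sqrt_le_left two_pos.le]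
      linarith
    calc inceptionScore q (p g₀) - inceptionScore q (p (a t)) ≤ d :=
          (sub_le_self _ (inceptionScore_pos q _).le).trans (inceptionScore_le hq_meas hq _)
      _ ≤ 64 * r / 2 := by linarith
      _ ≤ 64 * r / √((v : ℝ) + 1) := by gcongr
  · have hv : 1 ≤ v := Nat.pos_of_mul_pos_left (by lia : 0 < b * v)
    have hsqrt_le : √((v : ℝ) + 1) ≤ 2 * √(b * v : ℕ) := by
      rw [Real.sqrt_le_left (by positivity), mul_pow, Real.sq_sqrt (Nat.cast_nonneg _)]
      exact_mod_cast (by nlinarith : v + 1 ≤ 2 ^ 2 * (b * v))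
    calc inceptionScore q (p g₀) - inceptionScore q (p (a t)) ≤ 32 * r / √(b * v : ℕ) :=
          step_regret_le_of_two_le hq_meas hq hd hδ hrun hx ht hn
      _ = 64 * r / (2 * √(b * v : ℕ)) := by
          field_simp
          ring
      _ ≤ 64 * r / √((v : ℝ) + 1) := by gcongr

theorem regret_le_of_goodSamples [∀ g, IsProbabilityMeasure (p g)] (hq_meas : Measurable q)
    (hq : ∀ x, q x ∈ stdSimplex ℝ (Fin d)) (hd : 2 ≤ d) (hb : 1 ≤ b)
    (hδ : 1 ≤ Real.log (4 * d / (δ / T))) (hrun : IsRun q δ b T x a)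
    (hg₀ : inceptionScore q (p g₀) = ⨆ g, inceptionScore q (p g))
    (hx : GoodSamples q p g₀ (Real.log (4 * d / (δ / T))) (sampleSizes b T) x) :
    regret q p T a
      ≤ 128 * rate d (Real.log (4 * d / (δ / T))) (slope q p) * √(G * T) := by
  set r := rate d (Real.log (4 * d / (δ / T))) (slope q p)
  have hr : d ≤ r := natCast_le_rate hd hδ (slope_nonneg q p)
  have hr₀ : 0 ≤ r := d.cast_nonneg.trans hr
  calc regret q p T a ≤ ∑ t ∈ Finset.range T, 64 * r * (1 / √((visits a t (a t) : ℝ) + 1)) := by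
        rw [regret, ← hg₀]
        exact Finset.sum_le_sum fun t ht ↦
          step_regret_le hq_meas hq hd hb hδ hrun hx (Finset.mem_range.1 ht)
    _ ≤ 64 * r * (2 * √(G * T)) := by
        rw [← Finset.mul_sum]
        gcongr
        exact sum_one_div_sqrt_visits_le a T
    _ = 128 * r * √(G * T) := by ring

theorem regret_le_of_le [∀ g, IsProbabilityMeasure (p g)] (hq_meas : Measurable q)
    (hq : ∀ x, q x ∈ stdSimplex ℝ (Fin d)) {L : ℝ} (hd : 2 ≤ d) (hL : 1 ≤ L) (hTG : T ≤ G)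
    (a : ℕ → Fin G) :
    regret q p T a ≤ 128 * rate d L (slope q p) * √(G * T) := by
  have hr : d ≤ rate d L (slope q p) := natCast_le_rate hd hL (slope_nonneg q p)
  have hr₀ : 0 ≤ rate d L (slope q p) := d.cast_nonneg.trans hr
  calc regret q p T a ≤ d * T := regret_le_mul hq_meas hq T a
    _ = d * √(T * T) := by rw [Real.sqrt_mul_self T.cast_nonneg]
    _ ≤ 128 * rate d L (slope q p) * √(G * T) := by
        gcongr
        linarith

end Deterministic

section Probability

variable {𝒳 Ω : Type*} [MeasurableSpace 𝒳] [MeasurableSpace Ω] {μ : Measure Ω}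

/-- `Y 0, Y 1, …` is an i.i.d. sample from the distribution `p`. -/
structure IsIIDSample (μ : Measure Ω) (p : Measure 𝒳) (Y : ℕ → Ω → 𝒳) : Prop where
  measurable (i : ℕ) : Measurable (Y i)
  map_eq (i : ℕ) : μ.map (Y i) = p
  iIndepFun : iIndepFun Y μ

variable {p : Measure 𝒳} {Y : ℕ → Ω → 𝒳}

namespace IsIIDSample

theorem integral_comp (hY : IsIIDSample μ p Y) {f : 𝒳 → ℝ} (hf : Measurable f) (i : ℕ) :
    ∫ ω, f (Y i ω) ∂μ = ∫ y, f y ∂p := by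
  rw [← hY.map_eq i, integral_map (hY.measurable i).aemeasurable hf.aestronglyMeasurable]

theorem variance_comp (hY : IsIIDSample μ p Y) {f : 𝒳 → ℝ} (hf : Measurable f) (i : ℕ) :
    Var[fun ω ↦ f (Y i ω); μ] = Var[f; p] := by
  rw [← hY.map_eq i, variance_map hf.aemeasurable (hY.measurable i).aemeasurable]
  rfl

theorem iIndepFun_comp (hY : IsIIDSample μ p Y) {f : 𝒳 → ℝ} (hf : Measurable f) :
    ProbabilityTheory.iIndepFun (fun i ω ↦ f (Y i ω)) μ :=
  hY.iIndepFun.comp (fun _ ↦ f) fun _ ↦ hf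

variable [IsProbabilityMeasure μ]

theorem measureReal_lt_sampleMean_sub (hY : IsIIDSample μ p Y) {f : 𝒳 → ℝ} (hf : Measurable f)
    {a b : ℝ} (hab : ∀ y, f y ∈ Set.Icc a b) {L : ℝ} (hL : 0 ≤ L) {n : ℕ} (hn : 2 ≤ n) :
    μ.real {ω | bernsteinRadius L (b - a) (fun i ↦ f (Y i ω)) n
        < sampleMean (fun i ↦ f (Y i ω)) n - ∫ y, f y ∂p}
      ≤ 2 * Real.exp (-L) :=
  measureReal_bernsteinRadius_lt_sampleMean_sub (fun i ↦ hf.comp (hY.measurable i))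
    (fun _ ↦ ae_of_all _ fun _ ↦ hab _) (hY.iIndepFun_comp hf) (hY.integral_comp hf)
    (hY.variance_comp hf) hL hn

theorem measureReal_lt_abs_sampleMean_sub (hY : IsIIDSample μ p Y) {f : 𝒳 → ℝ}
    (hf : Measurable f) {a b : ℝ} (hab : ∀ y, f y ∈ Set.Icc a b) {L : ℝ} (hL : 0 ≤ L) {n : ℕ}
    (hn : 2 ≤ n) :
    μ.real {ω | bernsteinRadius L (b - a) (fun i ↦ f (Y i ω)) n
        < |sampleMean (fun i ↦ f (Y i ω)) n - ∫ y, f y ∂p|}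
      ≤ 3 * Real.exp (-L) :=
  measureReal_bernsteinRadius_lt_abs_sampleMean_sub (fun i ↦ hf.comp (hY.measurable i))
    (fun _ ↦ ae_of_all _ fun _ ↦ hab _) (hY.iIndepFun_comp hf) (hY.integral_comp hf)
    (hY.variance_comp hf) hL hn

variable {d : ℕ} {q : 𝒳 → Fin d → ℝ} {L : ℝ} {n : ℕ}

theorem measureReal_exists_lt_abs_sub_marginal_le (hY : IsIIDSample μ p Y)
    (hq_meas : Measurable q) (hq : ∀ x, q x ∈ stdSimplex ℝ (Fin d)) (hL : 0 ≤ L) (hn : 2 ≤ n) :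
    μ.real {ω | ∃ j, bernsteinRadius L 1 (fun i ↦ q (Y i ω) j) n
        < |sampleMean (fun i ↦ q (Y i ω) j) n - marginal q p j|}
      ≤ 3 * d * Real.exp (-L) := by
  have hclass (j : Fin d) := hY.measureReal_lt_abs_sampleMean_sub
    (measurable_pi_iff.1 hq_meas j) (fun x ↦ mem_Icc_of_mem_stdSimplex (hq x) j) hL hn
  simp only [sub_zero] at hclass
  rw [Set.ofPred_exists]
  calc _ ≤ ∑ _j : Fin d, 3 * Real.exp (-L) :=
        (measureReal_iUnion_fintype_le _).trans (Finset.sum_le_sum fun j _ ↦ hclass j)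
    _ = 3 * d * Real.exp (-L) := by
        rw [Finset.sum_const, Finset.card_univ, Fintype.card_fin, nsmul_eq_mul]
        ring

theorem measureReal_not_optimistic_le (hY : IsIIDSample μ p Y) (hq_meas : Measurable q)
    (hq : ∀ x, q x ∈ stdSimplex ℝ (Fin d)) (hL : 0 ≤ L) (hn : 2 ≤ n) :
    μ.real {ω | ¬ Optimistic q p L (Y · ω) n} ≤ (3 * d + 2) * Real.exp (-L) := by
  have hentropy := hY.measureReal_lt_sampleMean_sub (f := fun x ↦ entropy (q x))
    (measurable_entropy.comp hq_meas) (fun x ↦ entropy_mem_Icc (hq x)) hL hn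
  rw [sub_zero] at hentropy
  refine ((measureReal_mono ?_).trans (measureReal_union_le _ _)).trans ((add_le_add
    (hY.measureReal_exists_lt_abs_sub_marginal_le hq_meas hq hL hn) hentropy).trans_eq (by ring))
  intro ω hω
  by_contra h
  simp only [Set.mem_union, Set.mem_ofPred_eq, not_or, not_exists, not_lt] at h
  exact hω ⟨h.1, h.2⟩

theorem measureReal_not_accurate_le (hY : IsIIDSample μ p Y) (hq_meas : Measurable q)
    (hq : ∀ x, q x ∈ stdSimplex ℝ (Fin d)) (hL : 0 ≤ L) (hn : 2 ≤ n) :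
    μ.real {ω | ¬ Accurate q p L (Y · ω) n} ≤ (3 * d + 3) * Real.exp (-L) := by
  have hentropy := hY.measureReal_lt_abs_sampleMean_sub (f := fun x ↦ entropy (q x))
    (measurable_entropy.comp hq_meas) (fun x ↦ entropy_mem_Icc (hq x)) hL hn
  rw [sub_zero] at hentropy
  refine ((measureReal_mono ?_).trans (measureReal_union_le _ _)).trans ((add_le_add
    (hY.measureReal_exists_lt_abs_sub_marginal_le hq_meas hq hL hn) hentropy).trans_eq (by ring))
  intro ω hω
  by_contra h
  simp only [Set.mem_union, Set.mem_ofPred_eq, not_or, not_exists, not_lt] at h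
  obtain ⟨hlower, hupper⟩ := abs_le.1 h.2
  exact hω ⟨⟨h.1, hupper⟩, by linarith⟩

theorem isProbabilityMeasure (hY : IsIIDSample μ p Y) : IsProbabilityMeasure p :=
  hY.map_eq 0 ▸ Measure.isProbabilityMeasure_map (hY.measurable 0).aemeasurable

theorem ae_eq_zero_of_marginal_eq_zero (hY : IsIIDSample μ p Y) (hq_meas : Measurable q)
    (hq : ∀ x, q x ∈ stdSimplex ℝ (Fin d)) :
    ∀ᵐ ω ∂μ, ∀ i j, marginal q p j = 0 → q (Y i ω) j = 0 := by
  have := hY.isProbabilityMeasure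
  refine ae_all_iff.2 fun i ↦ ae_of_ae_map (hY.measurable i).aemeasurable
    (p := fun x ↦ ∀ j, marginal q p j = 0 → q x j = 0) ?_
  rw [hY.map_eq i]
  exact ISUCB.ae_eq_zero_of_marginal_eq_zero hq_meas hq p

end IsIIDSample

variable [IsProbabilityMeasure μ] {d G : ℕ} {q : 𝒳 → Fin d → ℝ} {p : Fin G → Measure 𝒳}
  {X : Fin G → ℕ → Ω → 𝒳} {L : ℝ} {N : Finset ℕ}

theorem measure_not_goodSamples_le (hX : ∀ g, IsIIDSample μ (p g) (X g)) (hq_meas : Measurable q)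
    (hq : ∀ x, q x ∈ stdSimplex ℝ (Fin d)) (hL : 0 ≤ L) (hN : ∀ n ∈ N, 2 ≤ n) (g₀ : Fin G) :
    μ {ω | ¬ GoodSamples q p g₀ L N fun g i ↦ X g i ω}
      ≤ ENNReal.ofReal (N.card * ((3 * d + 2) * Real.exp (-L)
        + G * ((3 * d + 3) * Real.exp (-(3 * L))))) := by
  set A := ⋃ n ∈ N, {ω | ¬ Optimistic q (p g₀) L (X g₀ · ω) n}
  set B := ⋃ g, ⋃ n ∈ N, {ω | ¬ Accurate q (p g) (3 * L) (X g · ω) n}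
  have hA : μ.real A ≤ N.card * ((3 * d + 2) * Real.exp (-L)) := by
    rw [← nsmul_eq_mul]
    exact (measureReal_biUnion_finset_le _ _).trans (Finset.sum_le_card_nsmul _ _ _ fun n hn ↦
      (hX g₀).measureReal_not_optimistic_le hq_meas hq hL (hN n hn))
  have hB : μ.real B ≤ G * (N.card * ((3 * d + 3) * Real.exp (-(3 * L)))) := by
    rw [← nsmul_eq_mul (N.card), ← nsmul_eq_mul, ← Fintype.card_fin G, ← Finset.card_univ]
    exact (measureReal_iUnion_fintype_le _).trans (Finset.sum_le_card_nsmul _ _ _ fun g _ ↦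
      (measureReal_biUnion_finset_le _ _).trans (Finset.sum_le_card_nsmul _ _ _ fun n hn ↦
        (hX g).measureReal_not_accurate_le hq_meas hq (by positivity) (hN n hn)))
  have hsub : {ω | ¬ GoodSamples q p g₀ L N fun g i ↦ X g i ω} ≤ᵐ[μ] (A ∪ B : Set Ω) := by
    filter_upwards [ae_all_iff.2 fun g ↦ (hX g).ae_eq_zero_of_marginal_eq_zero hq_meas hq]
      with ω hzero hω
    by_contra hAB
    obtain ⟨hA, hB⟩ := not_or.1 hAB
    simp only [A, B, Set.mem_iUnion, Set.mem_ofPred_eq, not_exists, not_not] at hA hB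
    exact hω ⟨hA, hB, hzero⟩
  calc _ ≤ μ (A ∪ B) := measure_mono_ae hsub
    _ = ENNReal.ofReal (μ.real (A ∪ B)) := by rw [ofReal_measureReal]
    _ ≤ _ := ENNReal.ofReal_le_ofReal
        ((measureReal_union_le A B).trans ((add_le_add hA hB).trans_eq (by ring)))

theorem failure_probability_le {T : ℕ} {δ : ℝ} (hd : 2 ≤ d) (hT : 1 ≤ T) (hGT : G ≤ T)
    (hδ₀ : 0 < δ) (hδ₁ : δ ≤ 1) (hL : 4 * d * T * Real.exp (-L) = δ) :
    ((T : ℝ) - 1) * ((3 * d + 2) * Real.exp (-L) + G * ((3 * d + 3) * Real.exp (-(3 * L))))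
      ≤ δ := by
  have hd₂ : (2 : ℝ) ≤ d := by exact_mod_cast hd
  have hT₁ : (1 : ℝ) ≤ T := by exact_mod_cast hT
  set r := Real.exp (-L)
  have hr : 0 < r := Real.exp_pos _
  have hcube : Real.exp (-(3 * L)) = r ^ 3 := by
    rw [← Real.exp_nat_mul]
    congr 1
    push_cast
    ring
  have hrT : T * r ≤ 1 / 8 := by
    have : 0 ≤ T * r := by positivity
    nlinarith
  have hoptimistic : (3 * d + 2) * r ≤ δ / T := by
    rw [le_div_iff₀ (by linarith), ← hL]
    nlinarith [mul_pos hr (zero_lt_one.trans_le hT₁)]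
  have haccurate : G * ((3 * d + 3) * r ^ 3) ≤ δ / T ^ 2 := by
    calc G * ((3 * d + 3) * r ^ 3) ≤ T * ((3 * d + 3 * d) * r ^ 3) := by
          gcongr
          linarith
      _ = 3 / 2 * (T * r) ^ 2 * (δ / T ^ 2) := by
          rw [← hL]
          field_simp
          ring
      _ ≤ 3 / 2 * (1 / 8) ^ 2 * (δ / T ^ 2) := by gcongr
      _ ≤ δ / T ^ 2 := by
          have : 0 ≤ δ / (T : ℝ) ^ 2 := by positivity
          linarith
  calc ((T : ℝ) - 1) * ((3 * d + 2) * r + G * ((3 * d + 3) * Real.exp (-(3 * L))))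
      ≤ (T - 1) * (δ / T + δ / T ^ 2) := by
        rw [hcube]
        gcongr
    _ = δ - δ / T ^ 2 := by
        field_simp
        ring
    _ ≤ δ := sub_le_self _ (by positivity)

end Probability

section Constants

variable {d G T : ℕ} {δ : ℝ}

theorem mul_exp_neg_log_eq (hd : 1 ≤ d) (hT : 1 ≤ T) (hδ : 0 < δ) :
    4 * d * T * Real.exp (-Real.log (4 * d * T / δ)) = δ := by
  rw [Real.exp_neg, Real.exp_log (by positivity)]
  field_simp

theorem one_le_log (hd : 1 ≤ d) (hT : 1 ≤ T) (hδ₀ : 0 < δ) (hδ₁ : δ ≤ 1) :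
    1 ≤ Real.log (4 * d * T / δ) := by
  have hdT : (1 : ℝ) ≤ d * T := by exact_mod_cast Nat.mul_pos hd hT
  rw [Real.le_log_iff_exp_le (by positivity), le_div_iff₀ hδ₀]
  nlinarith [Real.exp_one_lt_d9]

-- The factor `exp C` serves only to absorb `d²` and `√G`.
theorem rate_mul_sqrt_le {L m : ℝ} (hG : 1 ≤ G) (hL : 0 ≤ L) (hm : 0 ≤ m) (Δ : ℝ) :
    128 * rate d L m * √(G * T)
      ≤ 128 * L ^ 1 * (G * (Δ ^ 2)⁻¹ * Real.log d
        + Real.exp (128 * d + Real.log G / 2) *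
          ((d * m + Real.log d) * √T + Real.log T)) := by
  have : 0 ≤ Real.log d := Real.log_natCast_nonneg d
  have hlogT : 0 ≤ Real.log T := Real.log_natCast_nonneg T
  have hG₀ : (0 : ℝ) < G := by exact_mod_cast hG
  have hsqrt : √(G : ℝ) = Real.exp (Real.log G / 2) := by
    rw [← Real.log_sqrt hG₀.le, Real.exp_log (Real.sqrt_pos.2 hG₀)]
  have hsq : (d : ℝ) ^ 2 ≤ Real.exp (128 * d) := calc
    (d : ℝ) ^ 2 ≤ Real.exp d ^ 2 := by
      gcongr
      linarith [Real.add_one_le_exp (d : ℝ)]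
    _ = Real.exp (2 * d) := by rw [← Real.exp_nat_mul, Nat.cast_two]
    _ ≤ Real.exp (128 * d) := by
      gcongr
      norm_num
  calc 128 * rate d L m * √(G * T)
      = 128 * L ^ 1 * (0 + d ^ 2 * √G * ((d * m + Real.log d) * √T + 0)) := by
        rw [rate, Real.sqrt_mul hG₀.le]
        ring
    _ ≤ _ := by
        rw [Real.exp_add, ← hsqrt]
        gcongr
        positivity

end Constants

section Regret

variable {𝒳 Ω : Type*} [MeasurableSpace 𝒳] [MeasurableSpace Ω] {μ : Measure Ω}
  [IsProbabilityMeasure μ] {G d b T : ℕ} {δ : ℝ} {q : 𝒳 → Fin d → ℝ} {p : Fin G → Measure 𝒳}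
  {X : Fin G → ℕ → Ω → 𝒳} {a : Ω → ℕ → Fin G}

theorem measure_not_regret_le_of_le (hd : 2 ≤ d) (hb : 1 ≤ b) (hT : 1 ≤ T) (hGT : G ≤ T)
    (hδ₀ : 0 < δ) (hδ₁ : δ ≤ 1) (hq_meas : Measurable q) (hq : ∀ x, q x ∈ stdSimplex ℝ (Fin d))
    (hX : ∀ g, IsIIDSample μ (p g) (X g))
    (ha : ∀ᵐ ω ∂μ, IsRun q δ b T (fun g i ↦ X g i ω) (a ω)) :
    μ {ω | ¬ regret q p T (a ω)
        ≤ 128 * rate d (Real.log (4 * d * T / δ)) (slope q p) * √(G * T)}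
      ≤ ENNReal.ofReal δ := by
  have (g : Fin G) : IsProbabilityMeasure (p g) := (hX g).isProbabilityMeasure
  have hL : 1 ≤ Real.log (4 * d * T / δ) := one_le_log (by lia) hT hδ₀ hδ₁
  have hexp := mul_exp_neg_log_eq (by lia : 1 ≤ d) hT hδ₀
  rw [← div_div_eq_mul_div] at hL hexp ⊢
  set L := Real.log (4 * d / (δ / T))
  obtain ⟨ω₀⟩ := μ.nonempty_of_neZero
  have : Nonempty (Fin G) := ⟨a ω₀ 0⟩
  obtain ⟨g₀, hg₀⟩ := exists_eq_ciSup_of_finite (f := fun g ↦ inceptionScore q (p g))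
  calc μ {ω | ¬ regret q p T (a ω) ≤ 128 * rate d L (slope q p) * √(G * T)}
      ≤ μ {ω | ¬ GoodSamples q p g₀ L (sampleSizes b T) fun g i ↦ X g i ω} :=
        measure_mono_ae (ha.mono fun ω hrun hω hx ↦
          hω (regret_le_of_goodSamples hq_meas hq hd hb hL hrun hg₀ hx))
    _ ≤ ENNReal.ofReal ((sampleSizes b T).card * ((3 * d + 2) * Real.exp (-L)
          + G * ((3 * d + 3) * Real.exp (-(3 * L))))) :=
        measure_not_goodSamples_le hX hq_meas hq (zero_le_one.trans hL)
          (fun _ ↦ two_le_of_mem_sampleSizes) g₀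
    _ ≤ ENNReal.ofReal (((T : ℝ) - 1) * ((3 * d + 2) * Real.exp (-L)
          + G * ((3 * d + 3) * Real.exp (-(3 * L))))) := by
        gcongr
        rw [← Nat.cast_pred hT]
        exact_mod_cast card_sampleSizes_le b T
    _ ≤ ENNReal.ofReal δ :=
        ENNReal.ofReal_le_ofReal (failure_probability_le hd hT hGT hδ₀ hδ₁ hexp)

end Regret

end ISUCB

end

theorem theorem4_general {𝒳 Ω : Type*} [MeasurableSpace 𝒳] [MeasurableSpace Ω] {μ : Measure Ω}
    [IsProbabilityMeasure μ] {G d b T : ℕ} (hb : 1 ≤ b) (hT : 1 ≤ T) {δ : ℝ} (hδ₀ : 0 < δ)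
    (hδ₁ : δ ≤ 1) {q : 𝒳 → Fin d → ℝ} (hq_meas : Measurable q)
    (hq : ∀ x, q x ∈ stdSimplex ℝ (Fin d)) {p : Fin G → Measure 𝒳} {X : Fin G → ℕ → Ω → 𝒳}
    (hX : ∀ g, ISUCB.IsIIDSample μ (p g) (X g)) {a : Ω → ℕ → Fin G}
    (ha : ∀ᵐ ω ∂μ, ISUCB.IsRun q δ b T (fun g i ↦ X g i ω) (a ω)) :
    μ {ω | ¬ ISUCB.regret q p T (a ω) ≤
        128 * ISUCB.rate d (Real.log (4 * d * T / δ)) (ISUCB.slope q p) * √(G * T)}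
      ≤ ENNReal.ofReal δ := by
  obtain ⟨ω₀⟩ := μ.nonempty_of_neZero
  have (g : Fin G) : IsProbabilityMeasure (p g) := (hX g).isProbabilityMeasure
  have hd : 1 ≤ d := ISUCB.pos_of_mem_stdSimplex (hq (X (a ω₀ 0) 0 ω₀))
  have hL : 1 ≤ Real.log (4 * d * T / δ) := ISUCB.one_le_log hd hT hδ₀ hδ₁
  have of_forall {B : ℝ} (hB : ∀ ω, ISUCB.regret q p T (a ω) ≤ B) :
      μ {ω | ¬ ISUCB.regret q p T (a ω) ≤ B} ≤ ENNReal.ofReal δ := by simp [hB]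
  rcases hd.eq_or_lt with rfl | hd
  · have := ISUCB.slope_nonneg q p
    refine of_forall fun ω ↦ (ISUCB.regret_eq_zero hq T (a ω)).trans_le ?_
    unfold ISUCB.rate
    positivity
  rcases le_total T G with hTG | hGT
  · exact of_forall fun ω ↦ ISUCB.regret_le_of_le hq_meas hq hd hL hTG (a ω)
  exact ISUCB.measure_not_regret_le_of_le hd hb hT hGT hδ₀ hδ₁ hq_meas hq hX ha

theorem theorem4 :
    ∃ (K : ℝ) (k : ℕ) (C : ℕ → ℕ → ℝ), 0 < K ∧
      (∀ d G : ℕ, 1 ≤ d → 1 ≤ G → 0 ≤ C d G ∧ C d G ≤ K * d + Real.log G / 2) ∧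
      ∀ (G d b T : ℕ) (_hG : 1 ≤ G) (_hb : 1 ≤ b) (_hT : 1 ≤ T)
        (δ : ℝ) (_hδ₀ : 0 < δ) (_hδ₁ : δ < 1)
        -- the sample space, the classifier and the generative models
        (𝒳 : Type*) [MeasurableSpace 𝒳]
        (q : 𝒳 → Fin d → ℝ) (_hq_meas : Measurable q) (_hq : ∀ x, q x ∈ stdSimplex ℝ (Fin d))
        (p : Fin G → Measure 𝒳) [∀ g, IsProbabilityMeasure (p g)]
        -- the independent samples: `X g i` is the `i`-th sample generated by the model `g`
        (Ω : Type*) [MeasurableSpace Ω] (μ : Measure Ω) [IsProbabilityMeasure μ]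
        (X : Fin G → ℕ → Ω → 𝒳) (_hX_meas : ∀ g i, Measurable (X g i))
        (_hX_law : ∀ g i, μ.map (X g i) = p g)
        (_hX_indep : iIndepFun (fun s : Fin G × ℕ => X s.1 s.2) μ)
        -- the models picked by the algorithm
        (a : Ω → ℕ → Fin G)
        (_ha : ∀ᵐ ω ∂μ, ISUCB.IsRun q δ b T (fun g i => X g i ω) (a ω)),
        μ {ω | ¬ ISUCB.regret q p T (a ω) ≤
            K * Real.log (4 * d * T / δ) ^ k *
              (G * (ISUCB.gap q p ^ 2)⁻¹ * Real.log d
                + Real.exp (C d G) *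
                  ((d * ISUCB.slope q p + Real.log d) * Real.sqrt T + Real.log T))}
          ≤ ENNReal.ofReal δ := by
  refine ⟨128, 1, fun d G ↦ 128 * d + Real.log G / 2, by norm_num, fun d G _ _ ↦ ⟨?_, le_rfl⟩, ?_⟩
  · have := Real.log_natCast_nonneg G
    positivity
  intro G d b T hG hb hT δ hδ₀ hδ₁ 𝒳 _ q hq_meas hq p _ Ω _ μ _ X hX_meas hX_law hX_indep a ha
  have hX (g : Fin G) : ISUCB.IsIIDSample μ (p g) (X g) :=
    ⟨hX_meas g, hX_law g, hX_indep.precomp (g := (g, ·)) (Prod.mk_right_injective g)⟩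
  obtain ⟨ω₀⟩ := μ.nonempty_of_neZero
  have hd : 1 ≤ d := ISUCB.pos_of_mem_stdSimplex (hq (X ⟨0, hG⟩ 0 ω₀))
  have hL : 1 ≤ Real.log (4 * d * T / δ) := ISUCB.one_le_log hd hT hδ₀ hδ₁.le
  refine (measure_mono (Set.ofPred_subset_ofPred.2 fun ω hω h ↦ hω (h.trans ?_))).trans
    (theorem4_general hb hT hδ₀ hδ₁.le hq_meas hq hX ha)
  exact ISUCB.rate_mul_sqrt_le hG (zero_le_one.trans hL) (ISUCB.slope_nonneg q p) _
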